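/- Let $\Sigma$ be a finite alphabet with at least two symbols. A decision problem is a set $\mathcal P\subseteq\Sigma^*\times\Sigma^*$ of pairs $\langle D,P\rangle$, where $D$ is the data part and $P$ the problem part. A function $f:\Sigma^*\to\Sigma^*$ is linear-size if $|f(x)|=O(|x|)$, and it is NC computable if it is computable by a single program in polylogarithmic time on a parallel random-access machine with polynomially many processors. A random-access Turing machine is a multi-tape Turing machine with read-only input tapes (one for each argument) and work tapes, in which every such tape has an additional binary index tape; on entering a random access state, the machine moves the head of each non-index tape to the cell whose number is on the respective index tape, in one step. A function $g:\Sigma^*\times\Sigma^*\to\Sigma^*$ is PsT computable if there are a polynomial-time computable preprocessing function $\Pi$ on $\Sigma^*$ (its values are strings over $\Sigma$ and finitely many auxiliary symbols), a random-access Turing machine $M$ and a function $T:\mathbb N\to\mathbb N$ with $T(n)=o(n)$ such that, for all $x,y\in\Sigma^*$, $M$ on input $(\Pi(x),y)$ outputs $g(x,y)$ within $T(|x|)$ steps. Write $\mathcal P_1\le^{\rm PsT}_m\mathcal P_2$ if there are linear-size NC computable functions $f_1,f_2$ and a PsT computable function $g$ such that for all $D,P\in\Sigma^*$, $$\langle D,P\rangle\in\mathcal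 P_1\iff\langle f_1(D),\,g(f_2(D),P)\rangle\in\mathcal P_2 .$$ Theorem. The relation $\le^{\rm PsT}_m$ is transitive: if $\mathcal P_1\le^{\rm PsT}_m\mathcal P_2$ and $\mathcal P_2\le^{\rm PsT}_m\mathcal P_3$, then $\mathcal P_1\le^{\rm PsT}_m\mathcal P_3$. -/

import Mathlib

namespace PsT

/-! ### Random-access Turing machines -/

/-- A head movement. -/
inductive Move where
  | left
  | stay
  | right

/-- Tapes are one-way infinite (cells `0, 1, 2, …`); moving left on cell `0` has no effect. -/
def Move.apply : Move → ℕ → ℕ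
  | left, n => n - 1
  | stay, n => n
  | right, n => n + 1

/-- What a machine does in one ordinary step, for input tapes indexed by `I`, work tapes indexed
by `W`, work tape alphabet `K` (blank included) and set of states `Q`. There is one binary index
tape for every non-index tape. -/
structure Action (I W K Q : Type) where
  /-- the next state -/
  next : Q
  /-- the symbol written on each work tape -/
  write : W → K
  /-- the movement of the head of each non-index tape -/
  move : I ⊕ W → Move
  /-- the bit written on each index tape -/
  idxWrite : I ⊕ W → Bool
  /-- the movement of the head of each index tape -/
  idxMove : I ⊕ W → Move

/-- A deterministic random-access Turing machine with `m` read-only input tapes over the alphabet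
`A` (one for each argument of the function that is computed), `w + 1` work tapes, the first of
which holds the output, a string over `B`, and one binary index tape for each of these tapes.
The symbol `none` is the blank. -/
structure RATM (m : ℕ) (A B : Type) where
  /-- states -/
  State : Type
  [finState : Fintype State]
  /-- auxiliary work tape symbols -/
  Sym : Type
  [finSym : Fintype Sym]
  /-- number of work tapes other than the output tape -/
  w : ℕ
  start : State
  halt : State
  /-- the random access states -/
  access : Set State
  /-- the transition function -/
  δ : State → (Fin m → Option A) → (Fin (w + 1) → Option (B ⊕ Sym)) →
    (Fin m ⊕ Fin (w + 1) → Bool) → Action (Fin m) (Fin (w + 1)) (Option (B ⊕ Sym)) State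

namespace RATM

variable {m : ℕ} {A B : Type}

/-- A configuration. The content of a binary index tape is the finite set of the cells that
hold the bit `1`. -/
structure Config (M : RATM m A B) where
  state : M.State
  work : Fin (M.w + 1) → ℕ → Option (B ⊕ M.Sym)
  head : Fin m ⊕ Fin (M.w + 1) → ℕ
  idx : Fin m ⊕ Fin (M.w + 1) → Finset ℕ
  idxHead : Fin m ⊕ Fin (M.w + 1) → ℕ

/-- All work tapes are blank, all index tapes hold zeros only, all heads are on cell `0`. -/
def initial (M : RATM m A B) : Config M where
  state := M.start
  work := fun _ _ => none
  head := fun _ => 0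
  idx := fun _ => ∅
  idxHead := fun _ => 0

/-- The number on an index tape, in binary; cell `i` holds the digit of weight `2 ^ i`. -/
def idxValue (s : Finset ℕ) : ℕ := ∑ i ∈ s, 2 ^ i

/-- Writing a bit on an index tape. -/
def writeBit (s : Finset ℕ) (pos : ℕ) (b : Bool) : Finset ℕ :=
  if b then insert pos s else s.erase pos

/-- The action that the machine takes in the configuration `c` on the inputs `xs`. -/
def action (M : RATM m A B) (xs : Fin m → List A) (c : Config M) :
    Action (Fin m) (Fin (M.w + 1)) (Option (B ⊕ M.Sym)) M.State :=
  M.δ c.state (fun i => (xs i)[c.head (Sum.inl i)]?)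
    (fun j => c.work j (c.head (Sum.inr j)))
    (fun t => decide (c.idxHead t ∈ c.idx t))

open Classical in
/-- One step. When a random access state is entered, the head of every non-index tape goes to
the cell whose number is on the index tape of that tape. A halted machine does not move. -/
noncomputable def step (M : RATM m A B) (xs : Fin m → List A) (c : Config M) : Config M :=
  if c.state = M.halt then c
  else
    let a := M.action xs c
    let newIdx := fun t => writeBit (c.idx t) (c.idxHead t) (a.idxWrite t)
    { state := a.next
      work := fun j => Function.update (c.work j) (c.head (Sum.inr j)) (a.write j)
      head := fun t =>
        if a.next ∈ M.access then idxValue (newIdx t) else (a.move t).apply (c.head t)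
      idx := newIdx
      idxHead := fun t => (a.idxMove t).apply (c.idxHead t) }

/-- On the inputs `xs` the machine halts after at most `T` steps, and then its output tape holds
the string `out`, followed by blanks. -/
def OutputsWithin (M : RATM m A B) (xs : Fin m → List A) (out : List B) (T : ℕ) : Prop :=
  let c := (M.step xs)^[T] M.initial
  c.state = M.halt ∧ ∀ i : ℕ, c.work 0 i = out[i]?.map Sum.inl

end RATM

/-- `f` is computable in polynomial time. -/
def PTIMEComputable {A B : Type} (f : List A → List B) : Prop :=
  ∃ (M : RATM 1 A B) (k : ℕ), ∀ x : List A, M.OutputsWithin ![x] (f x) (x.length ^ k + k)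

/-! ### Parallel random-access machines and the class NC -/

/-- The state of a synchronous parallel random-access machine: `reg i r` is the content of the
local register `r` of the processor `i`, and `mem a j` is entry `j` of the array `a` of the shared
memory. A program mentions only finitely many registers and arrays. -/
structure PRAMState where
  reg : ℕ → ℕ → ℕ
  mem : ℕ → ℕ → ℕ

/-- The unit-cost instructions. -/
inductive PRAMInstr where
  /-- `r := n` -/
  | const (r n : ℕ)
  /-- `r :=` number of the processor -/
  | pid (r : ℕ)
  /-- `r := s + t` -/
  | add (r s t : ℕ)
  /-- `r := max (s - t) 0` -/
  | sub (r s t : ℕ)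
  /-- `r := ⌊s / 2⌋` -/
  | half (r s : ℕ)
  /-- `r := a[s]` -/
  | load (r a s : ℕ)
  /-- `a[s] := t` -/
  | store (a s t : ℕ)

/-- The processor `i` assigns the value `v i` to its register `r`, for every active `i`. -/
noncomputable def PRAMState.setReg (σ : PRAMState) (act : Set ℕ) (r : ℕ) (v : ℕ → ℕ) :
    PRAMState :=
  open Classical in
  { σ with reg := fun i => if i ∈ act then Function.update (σ.reg i) r (v i) else σ.reg i }

open Classical in
/-- All processors in `act` execute an instruction simultaneously. If several of them write to the
same place, then the one with the smallest number succeeds. -/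
noncomputable def PRAMInstr.apply (act : Set ℕ) (σ : PRAMState) : PRAMInstr → PRAMState
  | const r n => σ.setReg act r fun _ => n
  | pid r => σ.setReg act r fun i => i
  | add r s t => σ.setReg act r fun i => σ.reg i s + σ.reg i t
  | sub r s t => σ.setReg act r fun i => σ.reg i s - σ.reg i t
  | half r s => σ.setReg act r fun i => σ.reg i s / 2
  | load r a s => σ.setReg act r fun i => σ.mem a (σ.reg i s)
  | store a s t =>
    { σ with
      mem := Function.update σ.mem a fun j =>
        if ∃ i ∈ act, σ.reg i s = j then σ.reg (sInf {i | i ∈ act ∧ σ.reg i s = j}) t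
        else σ.mem a j }

/-- Programs; all processors run the same program in lockstep. -/
inductive PRAMProg where
  | instr (i : PRAMInstr)
  | seq (p q : PRAMProg)
  /-- the processors with `r ≠ 0` execute `p` while the others wait, then the others execute `q` -/
  | ite (r : ℕ) (p q : PRAMProg)
  /-- a processor executes `p` as long as its register `r` is not `0`, then it waits for the
  others -/
  | loop (r : ℕ) (p : PRAMProg)

/-- `PRAMExec p act σ t σ'`: if the processors in `act` execute the program `p` from the state `σ`,
then they terminate after exactly `t` parallel steps, in the state `σ'`. -/
inductive PRAMExec : PRAMProg → Set ℕ → PRAMState → ℕ → PRAMState → Prop where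
  | instr (i : PRAMInstr) (act : Set ℕ) (σ : PRAMState) :
      PRAMExec (.instr i) act σ 1 (i.apply act σ)
  | seq {p q : PRAMProg} {act : Set ℕ} {σ σ₁ σ₂ : PRAMState} {t₁ t₂ : ℕ} :
      PRAMExec p act σ t₁ σ₁ → PRAMExec q act σ₁ t₂ σ₂ →
      PRAMExec (.seq p q) act σ (t₁ + t₂) σ₂
  | ite {r : ℕ} {p q : PRAMProg} {act : Set ℕ} {σ σ₁ σ₂ : PRAMState} {t₁ t₂ : ℕ} :
      PRAMExec p {i | i ∈ act ∧ σ.reg i r ≠ 0} σ t₁ σ₁ →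
      PRAMExec q {i | i ∈ act ∧ σ.reg i r = 0} σ₁ t₂ σ₂ →
      PRAMExec (.ite r p q) act σ (1 + t₁ + t₂) σ₂
  | loop_stop {r : ℕ} {p : PRAMProg} {act : Set ℕ} {σ : PRAMState} :
      (∀ i ∈ act, σ.reg i r = 0) → PRAMExec (.loop r p) act σ 1 σ
  | loop_step {r : ℕ} {p : PRAMProg} {act : Set ℕ} {σ σ₁ σ₂ : PRAMState} {t₁ t₂ : ℕ} :
      (∃ i ∈ act, σ.reg i r ≠ 0) →
      PRAMExec p {i | i ∈ act ∧ σ.reg i r ≠ 0} σ t₁ σ₁ →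
      PRAMExec (.loop r p) {i | i ∈ act ∧ σ.reg i r ≠ 0} σ₁ t₂ σ₂ →
      PRAMExec (.loop r p) act σ (1 + t₁ + t₂) σ₂

section NC

variable {α : Type} [Fintype α]

/-- A string as an array: entry `i` is the (positive) number of the `i`-th symbol, and the entries
behind the end of the string are `0`. -/
noncomputable def encodeArray (x : List α) (i : ℕ) : ℕ :=
  match x[i]? with
  | none => 0
  | some a => (Fintype.equivFin α a : ℕ) + 1

/-- The initial state: the array `0` holds the input, everything else is `0`. -/
noncomputable def PRAMState.initial (x : List α) : PRAMState where
  reg := fun _ _ => 0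
  mem := fun a => if a = 0 then encodeArray x else fun _ => 0

/-- `f` is NC computable: one program computes it, with the output in the array `1`, in
polylogarithmic time on polynomially many processors. -/
def NCComputable (f : List α → List α) : Prop :=
  ∃ (p : PRAMProg) (k : ℕ), ∀ x : List α, ∃ (t : ℕ) (σ : PRAMState),
    PRAMExec p {i | i < x.length ^ k + k} (PRAMState.initial x) t σ ∧
    t ≤ k * Nat.log 2 x.length ^ k + k ∧
    σ.mem 1 = encodeArray (f x)

end NC

/-! ### The reduction -/

section Reduction

variable {α : Type}

/-- `f` is linear-size: `|f(x)| = O(|x|)`. -/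
def LinearSize (f : List α → List α) : Prop :=
  ∃ c : ℕ, ∀ x : List α, (f x).length ≤ c * x.length + c

/-- `g` is PsT computable: after a polynomial-time preprocessing `Pre` of the data part `x`, a
random-access Turing machine that is given `Pre x` and the problem part `y` computes `g x y` in
time `o(|x|)`. The preprocessed data may use finitely many symbols besides those of `α`. -/
def PsTComputable (g : List α → List α → List α) : Prop :=
  ∃ (r : ℕ) (Pre : List α → List (α ⊕ Fin r)) (M : RATM 2 (α ⊕ Fin r) α) (T : ℕ → ℕ),
    PTIMEComputable Pre ∧
    (fun n => (T n : ℝ)) =o[Filter.atTop] (fun n : ℕ => (n : ℝ)) ∧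
    ∀ x y : List α, M.OutputsWithin ![Pre x, y.map Sum.inl] (g x y) (T x.length)

/-- A decision problem is a set of pairs `(D, P)` of strings, a data part and a problem part. -/
abbrev DecisionProblem (α : Type) : Type := Set (List α × List α)

/-- Pseudo-sublinear-time reducibility. -/
def PsTReducible [Fintype α] (P₁ P₂ : DecisionProblem α) : Prop :=
  ∃ (f₁ f₂ : List α → List α) (g : List α → List α → List α),
    NCComputable f₁ ∧ LinearSize f₁ ∧ NCComputable f₂ ∧ LinearSize f₂ ∧ PsTComputable g ∧
    ∀ D P : List α, (D, P) ∈ P₁ ↔ (f₁ D, g (f₂ D) P) ∈ P₂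

end Reduction

end PsT

/-! The composed reduction sends the data part to `f₁' (f₁ D)`. Its second function must serve both
`g`, which needs `f₂ D`, and `g'`, which needs `f₂' (f₁ D)`, so it outputs a code of this pair; the
new problem part is `g'` applied to the second component and to the value of `g` at the first
component and `P`. It remains to see that the classes involved are closed under these operations.

NC functions of linear size can be composed and paired (`NCComputable.comp`,
`NCComputable.pairCode`). Both rest on `NCComputable.subroutine`: an injective renaming moves a
program to private registers and arrays, and the exact set of processors it expects is singled out
by computing the length of its input and a power of that length. Linear size keeps the resources of
a later stage within bounds in terms of the original input.

PsT functions can be composed (`PsTComputable.comp`). Decoding the pair and both preprocessings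
belong to the new preprocessing, which lays the two results side by side as two tracks of one
string, so that a cell number means the same for both machines. The machine for `g` runs on one
track; the machine for `g'` then runs on the other, with the output tape of the first as an input
tape (`Computes.seq`). In between, index tapes must be cleared and heads reset without spending time
linear in the data. This is possible because `n` steps touch only the first `n` cells of an index
tape (`FstInv.cleanup`). The time bounds are evaluated at lengths of components; they need not be
monotone, so running maxima replace them (`isLittleO_running_max`).

The pair is coded in blocks of four symbols: one processor writes one block in constant time, and a
finite transducer decodes. -/

namespace PsT

/-! ### Machines with arbitrary tape index sets and alphabets -/

/-- A random-access Turing machine whose tapes are indexed by arbitrary types and whose input and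
work tape symbols (blanks included) form arbitrary types. -/
structure TM (I A W K Q : Type) where
  start : Q
  halt : Q
  access : Set Q
  δ : Q → (I → A) → (W → K) → (I ⊕ W → Bool) → Action I W K Q

/-- A configuration of a `TM`. -/
structure Cfg (I W K Q : Type) where
  state : Q
  work : W → ℕ → K
  head : I ⊕ W → ℕ
  idx : I ⊕ W → Finset ℕ
  idxHead : I ⊕ W → ℕ

namespace Cfg

variable {I W K Q : Type}

open Classical in
/-- The configuration after an action has been performed. -/
noncomputable def perform (acc : Set Q) (a : Action I W K Q) (c : Cfg I W K Q) : Cfg I W K Q where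
  state := a.next
  work := fun j => Function.update (c.work j) (c.head (Sum.inr j)) (a.write j)
  head := fun t =>
    if a.next ∈ acc then RATM.idxValue (RATM.writeBit (c.idx t) (c.idxHead t) (a.idxWrite t))
    else (a.move t).apply (c.head t)
  idx := fun t => RATM.writeBit (c.idx t) (c.idxHead t) (a.idxWrite t)
  idxHead := fun t => (a.idxMove t).apply (c.idxHead t)

end Cfg

namespace TM

variable {I A W K Q : Type}

/-- The initial configuration, with all work tapes filled with `b`. -/
def initial (M : TM I A W K Q) (b : K) : Cfg I W K Q where
  state := M.start
  work := fun _ _ => b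
  head := fun _ => 0
  idx := fun _ => ∅
  idxHead := fun _ => 0

/-- The action taken in the configuration `c` when the input tapes hold `X`. -/
def action (M : TM I A W K Q) (X : I → ℕ → A) (c : Cfg I W K Q) : Action I W K Q :=
  M.δ c.state (fun i => X i (c.head (Sum.inl i))) (fun j => c.work j (c.head (Sum.inr j)))
    (fun t => decide (c.idxHead t ∈ c.idx t))

open Classical in
/-- One step; a halted machine does not move. -/
noncomputable def step (M : TM I A W K Q) (X : I → ℕ → A) (c : Cfg I W K Q) : Cfg I W K Q :=
  if c.state = M.halt then c else c.perform M.access (M.action X c)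

lemma step_of_halted (M : TM I A W K Q) (X : I → ℕ → A) {c : Cfg I W K Q}
    (h : c.state = M.halt) : M.step X c = c := if_pos h

lemma step_of_not_halted (M : TM I A W K Q) (X : I → ℕ → A) {c : Cfg I W K Q}
    (h : c.state ≠ M.halt) : M.step X c = c.perform M.access (M.action X c) := if_neg h

lemma iterate_step_of_halted (M : TM I A W K Q) (X : I → ℕ → A) {c : Cfg I W K Q}
    (h : c.state = M.halt) (n : ℕ) : (M.step X)^[n] c = c :=
  Function.iterate_fixed (M.step_of_halted X h) n

lemma iterate_step_of_le (M : TM I A W K Q) (X : I → ℕ → A) {c : Cfg I W K Q} {m n : ℕ}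
    (hmn : m ≤ n) (h : ((M.step X)^[m] c).state = M.halt) :
    (M.step X)^[n] c = (M.step X)^[m] c := by
  obtain ⟨k, rfl⟩ := Nat.exists_eq_add_of_le' hmn
  rw [Function.iterate_add_apply, M.iterate_step_of_halted X h]

/-- A halting run has a first halting time. -/
lemma exists_first_halt (M : TM I A W K Q) (X : I → ℕ → A) {c : Cfg I W K Q} {n : ℕ}
    (h : ((M.step X)^[n] c).state = M.halt) :
    ∃ m ≤ n, (M.step X)^[m] c = (M.step X)^[n] c ∧
      ∀ k < m, ((M.step X)^[k] c).state ≠ M.halt := by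
  classical
  have hex : ∃ m, ((M.step X)^[m] c).state = M.halt := ⟨n, h⟩
  refine ⟨Nat.find hex, Nat.find_le h, ?_, fun k hk => Nat.find_min hex hk⟩
  exact (M.iterate_step_of_le X (Nat.find_le h) (Nat.find_spec hex)).symm

end TM

/-- Some machine with finitely many tapes, symbols and states computes, for every `d`, the output
`out d` from the input tapes `inp d` within `time d` steps. -/
def Computes {D I A C : Type} (inp : D → I → ℕ → A) (out : D → ℕ → Option C)
    (time : D → ℕ) : Prop :=
  ∃ (W K Q : Type) (_ : Finite W) (_ : Finite K) (_ : Finite Q) (M : TM I A W K Q) (o : W)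
    (e : Option C → K), Function.Injective e ∧ ∀ d,
      ((M.step (inp d))^[time d] (M.initial (e none))).state = M.halt ∧
      ∀ i, ((M.step (inp d))^[time d] (M.initial (e none))).work o i = e (out d i)

lemma Computes.mono {D I A C : Type} {inp : D → I → ℕ → A} {out : D → ℕ → Option C}
    {t t' : D → ℕ} (h : Computes inp out t) (htt : ∀ d, t d ≤ t' d) : Computes inp out t' := by
  obtain ⟨W, K, Q, hW, hK, hQ, M, o, e, he, H⟩ := h
  refine ⟨W, K, Q, hW, hK, hQ, M, o, e, he, fun d => ?_⟩
  rw [M.iterate_step_of_le _ (htt d) (H d).1]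
  exact H d

/-- Computability is preserved under a change of parameters. -/
lemma Computes.comap {D D' I A C : Type} {inp : D → I → ℕ → A} {out : D → ℕ → Option C}
    {t : D → ℕ} (h : Computes inp out t) (φ : D' → D) :
    Computes (fun d => inp (φ d)) (fun d => out (φ d)) (fun d => t (φ d)) := by
  obtain ⟨W, K, Q, hW, hK, hQ, M, o, e, he, H⟩ := h
  exact ⟨W, K, Q, hW, hK, hQ, M, o, e, he, fun d => H (φ d)⟩

section Conversion

variable {m : ℕ} {A B : Type}

/-- A `RATM` as a `TM`. -/
def RATM.toTM (M : RATM m A B) :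
    TM (Fin m) (Option A) (Fin (M.w + 1)) (Option (B ⊕ M.Sym)) M.State where
  start := M.start
  halt := M.halt
  access := M.access
  δ := M.δ

/-- A configuration of a `RATM` as a configuration of the corresponding `TM`. -/
def RATM.Config.toCfg {M : RATM m A B} (c : M.Config) :
    Cfg (Fin m) (Fin (M.w + 1)) (Option (B ⊕ M.Sym)) M.State where
  state := c.state
  work := c.work
  head := c.head
  idx := c.idx
  idxHead := c.idxHead

lemma RATM.toCfg_step (M : RATM m A B) (xs : Fin m → List A) (c : M.Config) :
    (M.step xs c).toCfg = M.toTM.step (fun i h => (xs i)[h]?) c.toCfg := by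
  by_cases h : c.state = M.halt
  · rw [TM.step_of_halted _ _ (by exact h), RATM.step, if_pos h]
  · rw [TM.step_of_not_halted _ _ (by exact h), RATM.step, if_neg h]
    rfl

lemma RATM.toCfg_iterate (M : RATM m A B) (xs : Fin m → List A) (c : M.Config) (n : ℕ) :
    ((M.step xs)^[n] c).toCfg = (M.toTM.step (fun i h => (xs i)[h]?))^[n] c.toCfg := by
  induction n with
  | zero => rfl
  | succ n ih => rw [Function.iterate_succ_apply', Function.iterate_succ_apply', ← ih,
      RATM.toCfg_step]

lemma RATM.computes {D : Type} [Finite B] (M : RATM m A B) {xs : D → Fin m → List A}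
    {y : D → List B} {t : D → ℕ} (h : ∀ d, M.OutputsWithin (xs d) (y d) (t d)) :
    Computes (fun d i j => (xs d i)[j]?) (fun d j => (y d)[j]?) t := by
  have := M.finState
  have := M.finSym
  refine ⟨_, _, _, inferInstance, inferInstance, inferInstance, M.toTM, 0, Option.map Sum.inl,
    Option.map_injective Sum.inl_injective, fun d => ?_⟩
  have key := RATM.toCfg_iterate M (xs d) M.initial (t d)
  obtain ⟨h₁, h₂⟩ := h d
  have hi : M.initial.toCfg = M.toTM.initial (Option.map Sum.inl (none : Option B)) := rfl
  rw [hi] at key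
  rw [← key]
  exact ⟨h₁, h₂⟩

variable {W K Q : Type}

/-- A `TM` as a `RATM`, for an enumeration of the work tapes and an encoding of the symbols. -/
def TM.toRATM [Fintype K] [Fintype Q] (M : TM (Fin m) (Option A) W K Q) (w : ℕ)
    (ε : W ≃ Fin (w + 1)) (enc : K → Option (B ⊕ K)) (dec : Option (B ⊕ K) → K) :
    RATM m A B where
  State := Q
  Sym := K
  w := w
  start := M.start
  halt := M.halt
  access := M.access
  δ := fun q x k b =>
    let a := M.δ q x (fun j => dec (k (ε j))) (fun t => b (Sum.map id ε t))
    { next := a.next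
      write := fun j => enc (a.write (ε.symm j))
      move := fun t => a.move (Sum.map id ε.symm t)
      idxWrite := fun t => a.idxWrite (Sum.map id ε.symm t)
      idxMove := fun t => a.idxMove (Sum.map id ε.symm t) }

/-- A configuration of a `TM` as a configuration of the corresponding `RATM`. -/
def Cfg.toConfig [Fintype K] [Fintype Q] (M : TM (Fin m) (Option A) W K Q) (w : ℕ)
    (ε : W ≃ Fin (w + 1)) (enc : K → Option (B ⊕ K)) (dec : Option (B ⊕ K) → K)
    (c : Cfg (Fin m) W K Q) : (M.toRATM w ε enc dec).Config where
  state := c.state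
  work := fun j h => enc (c.work (ε.symm j) h)
  head := fun t => c.head (Sum.map id ε.symm t)
  idx := fun t => c.idx (Sum.map id ε.symm t)
  idxHead := fun t => c.idxHead (Sum.map id ε.symm t)

lemma TM.toConfig_step [Fintype K] [Fintype Q] (M : TM (Fin m) (Option A) W K Q) (w : ℕ)
    (ε : W ≃ Fin (w + 1)) {enc : K → Option (B ⊕ K)} {dec : Option (B ⊕ K) → K}
    (hdec : ∀ k, dec (enc k) = k) (xs : Fin m → List A) (c : Cfg (Fin m) W K Q) :
    (M.step (fun i h => (xs i)[h]?) c).toConfig M w ε enc dec =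
      (M.toRATM w ε enc dec).step xs (c.toConfig M w ε enc dec) := by
  by_cases h : c.state = M.halt
  · rw [TM.step_of_halted _ _ h, RATM.step, if_pos (by exact h)]
  · rw [TM.step_of_not_halted _ _ h, RATM.step, if_neg (by exact h)]
    have hmap : ∀ t : Fin m ⊕ W, Sum.map id ε.symm (Sum.map id ε t) = t := by
      rintro (t | t) <;> simp
    have hact : (M.toRATM w ε enc dec).action xs (c.toConfig M w ε enc dec) =
        { next := (M.action (fun i h => (xs i)[h]?) c).next
          write := fun j => enc ((M.action (fun i h => (xs i)[h]?) c).write (ε.symm j))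
          move := fun t => (M.action (fun i h => (xs i)[h]?) c).move (Sum.map id ε.symm t)
          idxWrite := fun t =>
            (M.action (fun i h => (xs i)[h]?) c).idxWrite (Sum.map id ε.symm t)
          idxMove := fun t =>
            (M.action (fun i h => (xs i)[h]?) c).idxMove (Sum.map id ε.symm t) } := by
      have hM : M.action (fun i h => (xs i)[h]?) c = M.δ c.state
          (fun i => (xs i)[c.head (Sum.inl i)]?)
          (fun j => dec (enc (c.work (ε.symm (ε j)) (c.head (Sum.inr (ε.symm (ε j)))))))
          (fun t => decide (c.idxHead (Sum.map id ε.symm (Sum.map id ε t)) ∈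
            c.idx (Sum.map id ε.symm (Sum.map id ε t)))) := by
        simp only [hdec, hmap, Equiv.symm_apply_apply]
        rfl
      rw [hM]
      rfl
    rw [hact]
    simp only [Cfg.toConfig, Cfg.perform]
    congr 1
    funext j h
    exact Function.apply_update (fun _ => enc) _ _ _ _

/-- All of `K` is taken as auxiliary alphabet; only the symbols in the range of `e` are recoded as
blank or output letters. The simulation needs no more than that `dec` is a left inverse of `enc`. -/
lemma Computes.exists_ratm {D : Type} {xs : D → Fin m → List A}
    {y : D → List B} {t : D → ℕ}
    (h : Computes (fun d i j => (xs d i)[j]?) (fun d j => (y d)[j]?) t) :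
    ∃ M : RATM m A B, ∀ d, M.OutputsWithin (xs d) (y d) (t d) := by
  classical
  obtain ⟨W, K, Q, hW, hK, hQ, M, o, e, he, H⟩ := h
  have := Fintype.ofFinite K
  have := Fintype.ofFinite Q
  obtain ⟨w, ε, hε⟩ : ∃ (w : ℕ) (ε : W ≃ Fin (w + 1)), ε o = 0 := by
    obtain ⟨n, ⟨ε⟩⟩ := Finite.exists_equiv_fin W
    cases n with
    | zero => exact (ε o).elim0
    -- The output has to be on tape 0, hence the swap.
    | succ w => exact ⟨w, ε.trans (Equiv.swap (ε o) 0), by simp⟩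
  let dec : Option (B ⊕ K) → K := fun s =>
    match s with
    | none => e none
    | some (Sum.inl b) => e (some b)
    | some (Sum.inr k) => k
  let enc : K → Option (B ⊕ K) := fun k =>
    if h : ∃ b, e b = k then (Classical.choose h).map Sum.inl else some (Sum.inr k)
  have henc : ∀ b, enc (e b) = b.map Sum.inl := fun b => by
    have hb : ∃ b', e b' = e b := ⟨b, rfl⟩
    simp only [enc, dif_pos hb, he (Classical.choose_spec hb)]
  have hdec : ∀ k, dec (enc k) = k := fun k => by
    by_cases hk : ∃ b, e b = k
    · obtain ⟨b, rfl⟩ := hk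
      rw [henc]
      cases b <;> rfl
    · simp only [enc, dif_neg hk, dec]
  refine ⟨M.toRATM w ε enc dec, fun d => ?_⟩
  have key : ∀ n, (((M.step (fun i j => (xs d i)[j]?))^[n] (M.initial (e none))).toConfig
      M w ε enc dec) = ((M.toRATM w ε enc dec).step (xs d))^[n]
        (M.toRATM w ε enc dec).initial := by
    intro n
    induction n with
    | zero =>
      simp only [Function.iterate_zero, id_eq, Cfg.toConfig, TM.initial, RATM.initial, henc]
      rfl
    | succ n ih => rw [Function.iterate_succ_apply', Function.iterate_succ_apply', ← ih,
        TM.toConfig_step M w ε hdec]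
  obtain ⟨h₁, h₂⟩ := H d
  simp only [RATM.OutputsWithin, ← key]
  refine ⟨h₁, fun i => ?_⟩
  have ho : ε.symm 0 = o := by rw [← hε, Equiv.symm_apply_apply]
  change enc (Cfg.work _ (ε.symm 0) i) = _
  rw [ho, h₂]
  exact henc _

end Conversion

/-! ### Sequential composition of machines -/

/-- Every step writes on every index tape; writing back the bit just read leaves the tape alone. -/
lemma RATM.writeBit_decide (s : Finset ℕ) (p : ℕ) :
    RATM.writeBit s p (decide (p ∈ s)) = s := by
  by_cases h : p ∈ s <;> simp [RATM.writeBit, h]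

lemma RATM.writeBit_subset_range {s : Finset ℕ} {p n : ℕ} (hs : s ⊆ Finset.range n)
    (hp : p ≤ n) (b : Bool) : RATM.writeBit s p b ⊆ Finset.range (n + 1) := by
  intro x hx
  have hx' : x = p ∨ x ∈ s := by
    cases b
    · exact Or.inr (Finset.mem_of_mem_erase (by simpa [RATM.writeBit] using hx))
    · simpa [RATM.writeBit] using hx
  rcases hx' with rfl | hx'
  · exact Finset.mem_range.2 (by omega)
  · have := Finset.mem_range.1 (hs hx')
    exact Finset.mem_range.2 (by omega)

lemma Move.apply_le (m : Move) (n : ℕ) : m.apply n ≤ n + 1 := by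
  cases m <;> simp only [Move.apply] <;> omega

/-- An action without effect on the work tapes and on the heads of the non-index tapes, if `k` are
the symbols read. -/
def Action.keep {I W K Q : Type} (q : Q) (k : W → K) (b : I ⊕ W → Bool)
    (mv : I ⊕ W → Move) : Action I W K Q where
  next := q
  write := k
  move := fun _ => Move.stay
  idxWrite := b
  idxMove := mv

open Classical in
lemma Cfg.perform_keep {I W K Q : Type} (acc : Set Q) (q : Q) (c : Cfg I W K Q)
    (b : I ⊕ W → Bool) (mv : I ⊕ W → Move) :
    c.perform acc (Action.keep q (fun j => c.work j (c.head (Sum.inr j))) b mv) =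
      { state := q
        work := c.work
        head := fun t => if q ∈ acc then
            RATM.idxValue (RATM.writeBit (c.idx t) (c.idxHead t) (b t)) else c.head t
        idx := fun t => RATM.writeBit (c.idx t) (c.idxHead t) (b t)
        idxHead := fun t => (mv t).apply (c.idxHead t) } := by
  simp only [Cfg.perform, Action.keep, Move.apply, Function.update_eq_self]
  congr

/-- The states of a sequential composition: a machine runs, the index tapes are cleared with the
help of a counter, all heads are reset, and another machine runs. -/
inductive SeqState (Q₁ Q₂ : Type) where
  | init
  | fst (q : Q₁)
  | rewind
  | erase
  | back
  | reset
  | snd (q : Q₂)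

instance SeqState.instFinite {Q₁ Q₂ : Type} [Finite Q₁] [Finite Q₂] :
    Finite (SeqState Q₁ Q₂) := by
  let f : SeqState Q₁ Q₂ → (Q₁ ⊕ Q₂) ⊕ Fin 5 := fun s =>
    match s with
    | .init => Sum.inr 0
    | .fst q => Sum.inl (Sum.inl q)
    | .rewind => Sum.inr 1
    | .erase => Sum.inr 2
    | .back => Sum.inr 3
    | .reset => Sum.inr 4
    | .snd q => Sum.inl (Sum.inr q)
  refine Finite.of_injective f fun s t h => ?_
  cases s <;> cases t <;> simp_all [f]

section Seq

variable {I A I₁ A₁ W₁ K₁ Q₁ I₂ A₂ W₂ K₂ Q₂ : Type}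

/-- The tapes of the first machine among the tapes of the composition. The work tape `none`
provides the index tape that serves as a counter. -/
def fstTape (τ : I₁ → I) : I₁ ⊕ W₁ → I ⊕ Option (W₁ ⊕ W₂)
  | Sum.inl i => Sum.inl (τ i)
  | Sum.inr w => Sum.inr (some (Sum.inl w))

/-- The tapes of the second machine among the tapes of the composition: its input tapes are
input tapes or the output tape `o` of the first machine. -/
def sndTape (τ : I₂ → Option I) (o : W₁) : I₂ ⊕ W₂ → I ⊕ Option (W₁ ⊕ W₂)
  | Sum.inl i => (τ i).elim (Sum.inr (some (Sum.inl o))) Sum.inl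
  | Sum.inr w => Sum.inr (some (Sum.inr w))

lemma fstTape_injective {τ : I₁ → I} (hτ : Function.Injective τ) :
    Function.Injective (fstTape (W₁ := W₁) (W₂ := W₂) τ) := by
  rintro (i | w) (j | v) h <;> simp_all [fstTape, hτ.eq_iff]

/-- Injectivity of `τ` also says that at most one input tape is sent to `none`, so the output tape
`o` is used at most once. -/
lemma sndTape_injective {τ : I₂ → Option I} (hτ : Function.Injective τ) (o : W₁) :
    Function.Injective (sndTape (W₂ := W₂) τ o) := by
  rintro (i | w) (j | v) h
  · have hij : τ i = τ j := by
      simp only [sndTape] at h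
      cases hi : τ i <;> cases hj : τ j <;> simp_all
    rw [hτ hij]
  · simp only [sndTape] at h
    cases hi : τ i <;> simp_all
  · simp only [sndTape] at h
    cases hj : τ j <;> simp_all
  · simpa [sndTape] using h

lemma fstTape_ne_clock (τ : I₁ → I) (t : I₁ ⊕ W₁) :
    fstTape (W₂ := W₂) τ t ≠ Sum.inr none := by
  cases t <;> simp [fstTape]

lemma sndTape_ne_clock (τ : I₂ → Option I) (o : W₁) (t : I₂ ⊕ W₂) :
    sndTape τ o t ≠ Sum.inr none := by
  rcases t with i | w
  · cases h : τ i <;> simp [sndTape, h]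
  · simp [sndTape]

open Classical in
/-- An action of the first machine as an action of the composition; the counter is increased. -/
noncomputable def Action.fst (τ : I₁ → I) (a : Action I₁ W₁ K₁ Q₁)
    (k : Option (W₁ ⊕ W₂) → K₁ × K₂) (b : I ⊕ Option (W₁ ⊕ W₂) → Bool) :
    Action I (Option (W₁ ⊕ W₂)) (K₁ × K₂) (SeqState Q₁ Q₂) where
  next := .fst a.next
  write := fun w =>
    match w with
    | some (Sum.inl w) => (a.write w, (k (some (Sum.inl w))).2)
    | w => k w
  move := Function.extend (fstTape τ) a.move fun _ => Move.stay
  idxWrite := fun t => if t = Sum.inr none then true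
    else Function.extend (fstTape τ) a.idxWrite b t
  idxMove := fun t => if t = Sum.inr none then Move.right
    else Function.extend (fstTape τ) a.idxMove (fun _ => Move.stay) t

/-- An action of the second machine as an action of the composition. -/
noncomputable def Action.snd (τ : I₂ → Option I) (o : W₁) (a : Action I₂ W₂ K₂ Q₂)
    (k : Option (W₁ ⊕ W₂) → K₁ × K₂) (b : I ⊕ Option (W₁ ⊕ W₂) → Bool) :
    Action I (Option (W₁ ⊕ W₂)) (K₁ × K₂) (SeqState Q₁ Q₂) where
  next := .snd a.next
  write := fun w =>
    match w with
    | some (Sum.inr w) => ((k (some (Sum.inr w))).1, a.write w)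
    | w => k w
  move := Function.extend (sndTape τ o) a.move fun _ => Move.stay
  idxWrite := Function.extend (sndTape τ o) a.idxWrite b
  idxMove := Function.extend (sndTape τ o) a.idxMove fun _ => Move.stay

open Classical in
/-- The sequential composition of two machines. -/
noncomputable def TM.seq (M₁ : TM I₁ A₁ W₁ K₁ Q₁) (M₂ : TM I₂ A₂ W₂ K₂ Q₂) (τ₁ : I₁ → I)
    (ρ₁ : I₁ → A → A₁) (o : W₁) (τ₂ : I₂ → Option I) (ρ₂ : I₂ → A → A₂)
    (σ : I₂ → K₁ → A₂) : TM I A (Option (W₁ ⊕ W₂)) (K₁ × K₂) (SeqState Q₁ Q₂) where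
  start := .init
  halt := .snd M₂.halt
  access := {s |
    match s with
    | .fst q => q ∈ M₁.access
    | .snd q => q ∈ M₂.access
    | .reset => True
    | _ => False}
  δ := fun s x k b =>
    match s with
    | .init => Action.keep (.fst M₁.start) k b
        fun t => if t = Sum.inr none then Move.right else Move.stay
    | .fst q =>
      if q = M₁.halt then Action.keep .rewind k b fun _ => Move.left
      else Action.fst τ₁ (M₁.δ q (fun i => ρ₁ i (x (τ₁ i)))
        (fun w => (k (some (Sum.inl w))).1) (fun t => b (fstTape τ₁ t))) k b
    | .rewind =>
      if b (Sum.inr none) then Action.keep .rewind k b fun _ => Move.left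
      else Action.keep .erase k (fun _ => false) fun _ => Move.right
    | .erase =>
      if b (Sum.inr none) then
        Action.keep .erase k (fun t => decide (t = Sum.inr none)) fun _ => Move.right
      else Action.keep .back k b fun _ => Move.left
    | .back =>
      if b (Sum.inr none) then Action.keep .back k b fun _ => Move.left
      else Action.keep .reset k b fun _ => Move.stay
    | .reset => Action.keep (.snd M₂.start) k b fun _ => Move.stay
    | .snd q => Action.snd τ₂ o (M₂.δ q
        (fun i => (τ₂ i).elim (σ i (k (some (Sum.inl o))).1) fun j => ρ₂ i (x j))
        (fun w => (k (some (Sum.inr w))).2) (fun t => b (sndTape τ₂ o t))) k b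

/-- The composition simulates the first machine, which has made `n` steps. -/
structure FstInv (τ₁ : I₁ → I) (b₁ : K₁) (b₂ : K₂) (n : ℕ) (c₁ : Cfg I₁ W₁ K₁ Q₁)
    (c : Cfg I (Option (W₁ ⊕ W₂)) (K₁ × K₂) (SeqState Q₁ Q₂)) : Prop where
  state : c.state = .fst c₁.state
  workFst : ∀ w h, c.work (some (Sum.inl w)) h = (c₁.work w h, b₂)
  workSnd : ∀ w h, c.work (some (Sum.inr w)) h = (b₁, b₂)
  head : ∀ t, c.head (fstTape τ₁ t) = c₁.head t
  idx : ∀ t, c.idx (fstTape τ₁ t) = c₁.idx t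
  idxHead : ∀ t, c.idxHead (fstTape τ₁ t) = c₁.idxHead t
  idxHead_le : ∀ t, t ≠ Sum.inr none → c.idxHead t ≤ n
  idx_subset : ∀ t, t ≠ Sum.inr none → c.idx t ⊆ Finset.range n
  clock : c.idx (Sum.inr none) = Finset.Icc 1 n
  clockHead : c.idxHead (Sum.inr none) = n + 1

/-- The composition simulates the second machine. -/
structure SndInv (τ₂ : I₂ → Option I) (o : W₁) (b₁ : K₁) (Y : ℕ → K₁) (c₂ : Cfg I₂ W₂ K₂ Q₂)
    (c : Cfg I (Option (W₁ ⊕ W₂)) (K₁ × K₂) (SeqState Q₁ Q₂)) : Prop where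
  state : c.state = .snd c₂.state
  workFst : ∀ h, (c.work (some (Sum.inl o)) h).1 = Y h
  workSnd : ∀ w h, c.work (some (Sum.inr w)) h = (b₁, c₂.work w h)
  head : ∀ t, c.head (sndTape τ₂ o t) = c₂.head t
  idx : ∀ t, c.idx (sndTape τ₂ o t) = c₂.idx t
  idxHead : ∀ t, c.idxHead (sndTape τ₂ o t) = c₂.idxHead t

variable {M₁ : TM I₁ A₁ W₁ K₁ Q₁} {M₂ : TM I₂ A₂ W₂ K₂ Q₂} {τ₁ : I₁ → I}
  {ρ₁ : I₁ → A → A₁} {o : W₁} {τ₂ : I₂ → Option I} {ρ₂ : I₂ → A → A₂} {σ : I₂ → K₁ → A₂}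
  {b₁ : K₁} {b₂ : K₂} {X : I → ℕ → A} {X₁ : I₁ → ℕ → A₁} {X₂ : I₂ → ℕ → A₂}

/-- The extra first step moves the clock head off cell 0. That cell stays unmarked and later reveals
the left end of the tape, which a head cannot detect otherwise. -/
lemma FstInv.initial (M₁ : TM I₁ A₁ W₁ K₁ Q₁) (M₂ : TM I₂ A₂ W₂ K₂ Q₂) (τ₁ : I₁ → I)
    (ρ₁ : I₁ → A → A₁) (o : W₁) (τ₂ : I₂ → Option I) (ρ₂ : I₂ → A → A₂) (σ : I₂ → K₁ → A₂)
    (b₁ : K₁) (b₂ : K₂) (X : I → ℕ → A) :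
    FstInv τ₁ b₁ b₂ 0 (M₁.initial b₁) ((M₁.seq M₂ τ₁ ρ₁ o τ₂ ρ₂ σ).step X
      ((M₁.seq M₂ τ₁ ρ₁ o τ₂ ρ₂ σ).initial (b₁, b₂))) := by
  set N := M₁.seq M₂ τ₁ ρ₁ o τ₂ ρ₂ σ
  rw [N.step_of_not_halted X (by simp [N, TM.seq, TM.initial])]
  have hact : N.action X (N.initial (b₁, b₂)) = Action.keep (.fst M₁.start)
      (fun j => (N.initial (b₁, b₂)).work j ((N.initial (b₁, b₂)).head (Sum.inr j)))
      (fun t => decide ((N.initial (b₁, b₂)).idxHead t ∈ (N.initial (b₁, b₂)).idx t))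
      (fun t => open Classical in if t = Sum.inr none then Move.right else Move.stay) := rfl
  rw [hact, Cfg.perform_keep]
  constructor <;> simp [TM.initial, RATM.writeBit, RATM.idxValue, Move.apply]
  · simp [fstTape_ne_clock]
  · intro t ht
    simp [ht]

lemma FstInv.step (hτ : Function.Injective τ₁) (hX : ∀ i h, X₁ i h = ρ₁ i (X (τ₁ i) h))
    {n : ℕ} {c₁ : Cfg I₁ W₁ K₁ Q₁}
    {c : Cfg I (Option (W₁ ⊕ W₂)) (K₁ × K₂) (SeqState Q₁ Q₂)}
    (hc : FstInv τ₁ b₁ b₂ n c₁ c) (hn : c₁.state ≠ M₁.halt) :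
    FstInv τ₁ b₁ b₂ (n + 1) (M₁.step X₁ c₁) ((M₁.seq M₂ τ₁ ρ₁ o τ₂ ρ₂ σ).step X c) := by
  have hτ' := fstTape_injective (W₁ := W₁) (W₂ := W₂) hτ
  set N := M₁.seq M₂ τ₁ ρ₁ o τ₂ ρ₂ σ
  rw [N.step_of_not_halted X (by simp [N, TM.seq, hc.state]), M₁.step_of_not_halted X₁ hn]
  set a := M₁.action X₁ c₁
  have hact : N.action X c = Action.fst τ₁ a (fun j => c.work j (c.head (Sum.inr j)))
      (fun t => decide (c.idxHead t ∈ c.idx t)) := by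
    have h₁ : ∀ i, c.head (Sum.inl (τ₁ i)) = c₁.head (Sum.inl i) := fun i => hc.head (Sum.inl i)
    simp only [N, TM.action, TM.seq, hc.state, if_neg hn, a, hc.workFst, hc.idx, hc.idxHead, hX,
      h₁]
    congr 2
    funext w
    rw [← hc.head (Sum.inr w)]
    rfl
  rw [hact]
  have hwh : ∀ w, c.head (Sum.inr (some (Sum.inl w))) = c₁.head (Sum.inr w) :=
    fun w => hc.head (Sum.inr w)
  have hacc : SeqState.fst a.next ∈ N.access ↔ a.next ∈ M₁.access := Iff.rfl
  constructor
  · rfl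
  · intro w h
    simp only [Cfg.perform, Action.fst, hwh, hc.workFst, Function.update_apply]
    split_ifs <;> rfl
  · intro w h
    simp only [Cfg.perform, Action.fst, hc.workSnd, Function.update_apply]
    split_ifs <;> rfl
  · intro t
    simp only [Cfg.perform, Action.fst, if_neg (fstTape_ne_clock τ₁ t),
      hτ'.extend_apply, hc.idx, hc.idxHead, hc.head]
    by_cases hq : a.next ∈ M₁.access <;> simp [hacc, hq]
  · intro t
    simp only [Cfg.perform, Action.fst, if_neg (fstTape_ne_clock τ₁ t),
      hτ'.extend_apply, hc.idx, hc.idxHead]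
  · intro t
    simp only [Cfg.perform, Action.fst, if_neg (fstTape_ne_clock τ₁ t),
      hτ'.extend_apply, hc.idxHead]
  · intro t ht
    exact (Move.apply_le _ _).trans (by have := hc.idxHead_le t ht; omega)
  · intro t ht
    exact RATM.writeBit_subset_range (hc.idx_subset t ht) (hc.idxHead_le t ht) _
  · simp only [Cfg.perform, Action.fst, if_true, hc.clock, hc.clockHead, RATM.writeBit]
    ext x
    simp only [Finset.mem_insert, Finset.mem_Icc]
    omega
  · simp only [Cfg.perform, Action.fst, if_true, hc.clockHead, Move.apply]

lemma FstInv.iterate (hτ : Function.Injective τ₁) (hX : ∀ i h, X₁ i h = ρ₁ i (X (τ₁ i) h))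
    {c₁ : Cfg I₁ W₁ K₁ Q₁} {c : Cfg I (Option (W₁ ⊕ W₂)) (K₁ × K₂) (SeqState Q₁ Q₂)}
    (hc : FstInv τ₁ b₁ b₂ 0 c₁ c) {n : ℕ}
    (hn : ∀ k < n, ((M₁.step X₁)^[k] c₁).state ≠ M₁.halt) :
    FstInv τ₁ b₁ b₂ n ((M₁.step X₁)^[n] c₁)
      (((M₁.seq M₂ τ₁ ρ₁ o τ₂ ρ₂ σ).step X)^[n] c) := by
  induction n with
  | zero => exact hc
  | succ n ih =>
    rw [Function.iterate_succ_apply', Function.iterate_succ_apply']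
    exact (ih fun k hk => hn k (by omega)).step hτ hX (hn n (by omega))

/-- In this phase the output tape of the first machine is only read, so `Y` serves as the fixed
content of an input tape. -/
lemma SndInv.step (hτ : Function.Injective τ₂) {Y : ℕ → K₁}
    (hX : ∀ i h, X₂ i h = (τ₂ i).elim (σ i (Y h)) fun j => ρ₂ i (X j h))
    {c₂ : Cfg I₂ W₂ K₂ Q₂} {c : Cfg I (Option (W₁ ⊕ W₂)) (K₁ × K₂) (SeqState Q₁ Q₂)}
    (hc : SndInv τ₂ o b₁ Y c₂ c) :
    SndInv τ₂ o b₁ Y (M₂.step X₂ c₂) ((M₁.seq M₂ τ₁ ρ₁ o τ₂ ρ₂ σ).step X c) := by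
  have hτ' := sndTape_injective (W₂ := W₂) hτ o
  set N := M₁.seq M₂ τ₁ ρ₁ o τ₂ ρ₂ σ
  by_cases hn : c₂.state = M₂.halt
  · rw [M₂.step_of_halted X₂ hn, N.step_of_halted X (by rw [hc.state, hn]; rfl)]
    exact hc
  rw [N.step_of_not_halted X (by simp [N, TM.seq, hc.state, hn]), M₂.step_of_not_halted X₂ hn]
  set a := M₂.action X₂ c₂
  have hwh : ∀ w, c.head (Sum.inr (some (Sum.inr w))) = c₂.head (Sum.inr w) :=
    fun w => hc.head (Sum.inr w)
  have hact : N.action X c = Action.snd τ₂ o a (fun j => c.work j (c.head (Sum.inr j)))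
      (fun t => decide (c.idxHead t ∈ c.idx t)) := by
    have h₁ : (fun i => (τ₂ i).elim
        (σ i (c.work (some (Sum.inl o)) (c.head (Sum.inr (some (Sum.inl o))))).1)
        (fun j => ρ₂ i (X j (c.head (Sum.inl j))))) =
        fun i => X₂ i (c₂.head (Sum.inl i)) := by
      funext i
      rw [hX, ← hc.head (Sum.inl i)]
      cases hi : τ₂ i <;> simp [sndTape, hi, hc.workFst]
    simp only [N, TM.action, TM.seq, hc.state, a, hc.workSnd, hc.idx, hc.idxHead, h₁, hwh]
  rw [hact]
  have hacc : SeqState.snd a.next ∈ N.access ↔ a.next ∈ M₂.access := Iff.rfl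
  constructor
  · rfl
  · intro h
    simp only [Cfg.perform, Action.snd, Function.update_eq_self, hc.workFst]
  · intro w h
    simp only [Cfg.perform, Action.snd, hwh, hc.workSnd, Function.update_apply]
    split_ifs <;> rfl
  · intro t
    simp only [Cfg.perform, Action.snd, hτ'.extend_apply, hc.idx, hc.idxHead, hc.head]
    by_cases hq : a.next ∈ M₂.access <;> simp [hacc, hq]
  · intro t
    simp only [Cfg.perform, Action.snd, hτ'.extend_apply, hc.idx, hc.idxHead]
  · intro t
    simp only [Cfg.perform, Action.snd, hτ'.extend_apply, hc.idxHead]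

open Classical in
/-- The index tapes other than the counter are cleared, and all heads are reset. -/
lemma FstInv.cleanup {n : ℕ} {c₁ : Cfg I₁ W₁ K₁ Q₁}
    {c : Cfg I (Option (W₁ ⊕ W₂)) (K₁ × K₂) (SeqState Q₁ Q₂)}
    (hc : FstInv τ₁ b₁ b₂ n c₁ c) (hn : c₁.state = M₁.halt) :
    SndInv τ₂ o b₁ (c₁.work o) (M₂.initial b₂)
      (((M₁.seq M₂ τ₁ ρ₁ o τ₂ ρ₂ σ).step X)^[3 * n + 5] c) := by
  set N := M₁.seq M₂ τ₁ ρ₁ o τ₂ ρ₂ σ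
  -- The clock head starts at `n + 1` and no other index head is further right. A left move on cell
  -- 0 has no effect, so all of them are on cell 0 when the clock head gets there.
  have hrewind : ∀ j ≤ n, (N.step X)^[j + 1] c =
      { state := .rewind, work := c.work, head := c.head, idx := c.idx
        idxHead := fun t => c.idxHead t - 1 - j } := by
    intro j hj
    induction j with
    | zero =>
      rw [Function.iterate_one, N.step_of_not_halted X (by simp [N, TM.seq, hc.state])]
      have hact : N.action X c = Action.keep .rewind (fun j => c.work j (c.head (Sum.inr j)))
          (fun t => decide (c.idxHead t ∈ c.idx t)) (fun _ => Move.left) := by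
        simp only [N, TM.action, TM.seq, hc.state, if_pos hn]
      rw [hact, Cfg.perform_keep]
      simp [RATM.writeBit_decide, N, TM.seq, Move.apply]
    | succ j ih =>
      rw [Function.iterate_succ_apply', ih (by omega),
        N.step_of_not_halted X (by simp [N, TM.seq])]
      set c' : Cfg I (Option (W₁ ⊕ W₂)) (K₁ × K₂) (SeqState Q₁ Q₂) := Cfg.mk _ _ _ _ _ with hc'
      have hact : N.action X c' = Action.keep .rewind
          (fun j => c'.work j (c'.head (Sum.inr j)))
          (fun t => decide (c'.idxHead t ∈ c'.idx t)) (fun _ => Move.left) := by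
        have : c.idxHead (Sum.inr none) - 1 - j ∈ c.idx (Sum.inr none) := by
          rw [hc.clock, hc.clockHead, Finset.mem_Icc]
          omega
        simp [N, TM.action, TM.seq, hc', this]
      rw [hact, Cfg.perform_keep]
      simp [RATM.writeBit_decide, N, TM.seq, Move.apply, hc', Nat.sub_sub, add_assoc]
  have hhead : ∀ t, c.idxHead t - 1 - n = 0 := by
    intro t
    by_cases ht : t = Sum.inr none
    · rw [ht, hc.clockHead]
      omega
    · have := hc.idxHead_le t ht
      omega
  -- The step that leaves `rewind` already erases cell 0. The clock keeps its marks on cells `1` to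
  -- `n` while the other tapes receive zeros, and the sweep ends at the unmarked clock cell `n + 1`.
  have herase : ∀ j ≤ n, (N.step X)^[j + 1 + (n + 1)] c =
      { state := .erase, work := c.work, head := c.head
        idx := fun t => if t = Sum.inr none then Finset.Icc 1 n else
          (c.idx t).filter fun x => j < x
        idxHead := fun t => j + 1 } := by
    intro j hj
    induction j with
    | zero =>
      rw [Function.iterate_add_apply, hrewind n le_rfl, Function.iterate_one,
        N.step_of_not_halted X (by simp [N, TM.seq])]
      simp only [hhead]
      set c' : Cfg I (Option (W₁ ⊕ W₂)) (K₁ × K₂) (SeqState Q₁ Q₂) := Cfg.mk _ _ _ _ _ with hc'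
      have hact : N.action X c' = Action.keep .erase
          (fun j => c'.work j (c'.head (Sum.inr j)))
          (fun t => false) (fun _ => Move.right) := by
        simp [N, TM.action, TM.seq, hc', hc.clock]
      rw [hact, Cfg.perform_keep]
      simp only [hc', N, TM.seq, Move.apply, RATM.writeBit, Set.mem_ofPred_eq, if_false]
      congr 1
      funext t
      by_cases ht : t = Sum.inr none
      · simp [ht, hc.clock]
      · ext x
        simp [ht, Nat.pos_iff_ne_zero, and_comm]
    | succ j ih =>
      rw [show j + 1 + 1 + (n + 1) = (j + 1 + (n + 1)) + 1 by ring,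
        Function.iterate_succ_apply', ih (by omega),
        N.step_of_not_halted X (by simp [N, TM.seq])]
      set c' : Cfg I (Option (W₁ ⊕ W₂)) (K₁ × K₂) (SeqState Q₁ Q₂) := Cfg.mk _ _ _ _ _ with hc'
      have hact : N.action X c' = Action.keep .erase
          (fun j => c'.work j (c'.head (Sum.inr j)))
          (fun t => decide (t = Sum.inr none)) (fun _ => Move.right) := by
        have : j + 1 ≤ n := hj
        simp [N, TM.action, TM.seq, hc', this]
      rw [hact, Cfg.perform_keep]
      simp only [hc', N, TM.seq, Move.apply, RATM.writeBit, Set.mem_ofPred_eq, if_false]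
      congr 1
      funext t
      by_cases ht : t = Sum.inr none
      · simp [ht]
        omega
      · ext x
        simp [ht]
        grind
  -- The index heads must return too, and the surviving clock marks tell when to stop.
  have hback : ∀ j ≤ n, (N.step X)^[j + 1 + (n + 1 + (n + 1))] c =
      { state := .back, work := c.work, head := c.head
        idx := fun t => if t = Sum.inr none then Finset.Icc 1 n else ∅
        idxHead := fun t => n - j } := by
    intro j hj
    induction j with
    | zero =>
      rw [Function.iterate_add_apply, herase n le_rfl, Function.iterate_one,
        N.step_of_not_halted X (by simp [N, TM.seq])]
      set c' : Cfg I (Option (W₁ ⊕ W₂)) (K₁ × K₂) (SeqState Q₁ Q₂) := Cfg.mk _ _ _ _ _ with hc'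
      have hact : N.action X c' = Action.keep .back
          (fun j => c'.work j (c'.head (Sum.inr j)))
          (fun t => decide (c'.idxHead t ∈ c'.idx t)) (fun _ => Move.left) := by
        simp [N, TM.action, TM.seq, hc']
      rw [hact, Cfg.perform_keep]
      simp only [RATM.writeBit_decide]
      simp only [hc', N, TM.seq, Move.apply, Set.mem_ofPred_eq, if_false]
      congr 1
      funext t
      by_cases ht : t = Sum.inr none
      · simp [ht]
      · simp only [ht, if_false]
        refine Finset.filter_eq_empty_iff.2 fun x hx => ?_
        have := Finset.mem_range.1 (hc.idx_subset t ht hx)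
        omega
    | succ j ih =>
      rw [show j + 1 + 1 + (n + 1 + (n + 1)) = (j + 1 + (n + 1 + (n + 1))) + 1 by ring,
        Function.iterate_succ_apply', ih (by omega),
        N.step_of_not_halted X (by simp [N, TM.seq])]
      set c' : Cfg I (Option (W₁ ⊕ W₂)) (K₁ × K₂) (SeqState Q₁ Q₂) := Cfg.mk _ _ _ _ _ with hc'
      have hact : N.action X c' = Action.keep .back
          (fun j => c'.work j (c'.head (Sum.inr j)))
          (fun t => decide (c'.idxHead t ∈ c'.idx t)) (fun _ => Move.left) := by
        have : 1 ≤ n - j := by omega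
        simp [N, TM.action, TM.seq, hc', this]
      rw [hact, Cfg.perform_keep]
      simp only [RATM.writeBit_decide]
      simp [hc', N, TM.seq, Move.apply, Nat.sub_sub]
  -- A cleared index tape has value 0, so one random access sends the heads to cell 0. The head
  -- governed by the clock may land elsewhere, but the second machine does not use that tape.
  have hreset : ∃ H : I ⊕ Option (W₁ ⊕ W₂) → ℕ, (∀ t, t ≠ Sum.inr none → H t = 0) ∧
      (N.step X)^[1 + (n + 1 + (n + 1 + (n + 1)))] c =
      { state := .reset, work := c.work, head := H
        idx := fun t => if t = Sum.inr none then Finset.Icc 1 n else ∅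
        idxHead := fun t => 0 } := by
    rw [Function.iterate_add_apply, hback n le_rfl, Function.iterate_one,
      N.step_of_not_halted X (by simp [N, TM.seq])]
    set c' : Cfg I (Option (W₁ ⊕ W₂)) (K₁ × K₂) (SeqState Q₁ Q₂) := Cfg.mk _ _ _ _ _ with hc'
    have hact : N.action X c' = Action.keep .reset
        (fun j => c'.work j (c'.head (Sum.inr j)))
        (fun t => decide (c'.idxHead t ∈ c'.idx t)) (fun _ => Move.stay) := by
      simp [N, TM.action, TM.seq, hc']
    rw [hact, Cfg.perform_keep]
    simp only [RATM.writeBit_decide]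
    refine ⟨fun t => RATM.idxValue (c'.idx t), fun t ht => ?_, ?_⟩
    · simp [hc', ht, RATM.idxValue]
    · simp [hc', Move.apply, N, TM.seq]
  obtain ⟨H, hH, hreset⟩ := hreset
  -- Three sweeps of `n + 1` steps, one step for the reset and one to start the second machine.
  rw [show 3 * n + 5 = 1 + (n + 1 + (n + 1 + (n + 1))) + 1 by ring, Function.iterate_succ_apply',
    hreset, N.step_of_not_halted X (by simp [N, TM.seq])]
  set c' : Cfg I (Option (W₁ ⊕ W₂)) (K₁ × K₂) (SeqState Q₁ Q₂) := Cfg.mk _ _ _ _ _ with hc'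
  have hact : N.action X c' = Action.keep (.snd M₂.start)
      (fun j => c'.work j (c'.head (Sum.inr j)))
      (fun t => decide (c'.idxHead t ∈ c'.idx t)) (fun _ => Move.stay) := by
    simp [N, TM.action, TM.seq, hc']
  rw [hact, Cfg.perform_keep]
  simp only [RATM.writeBit_decide]
  constructor
  · rfl
  · intro h
    simp [hc', hc.workFst]
  · intro w h
    simp [hc', hc.workSnd, TM.initial]
  · intro t
    simp [hc', hH _ (sndTape_ne_clock τ₂ o t), sndTape_ne_clock, TM.initial, RATM.idxValue]
  · intro t
    simp [hc', sndTape_ne_clock, TM.initial]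
  · intro t
    simp [hc', TM.initial, Move.apply]

end Seq

/-- Sequential composition: the second machine reads input tapes and the output of the first. -/
theorem Computes.seq {D I A I₁ A₁ B I₂ A₂ C : Type} {inp : D → I → ℕ → A}
    {inp₁ : D → I₁ → ℕ → A₁} {inp₂ : D → I₂ → ℕ → A₂} {out₁ : D → ℕ → Option B}
    {out₂ : D → ℕ → Option C} {t₁ t₂ : D → ℕ}
    (h₁ : Computes inp₁ out₁ t₁) (h₂ : Computes inp₂ out₂ t₂)
    (τ₁ : I₁ → I) (hτ₁ : Function.Injective τ₁) (ρ₁ : I₁ → A → A₁)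
    (hinp₁ : ∀ d i h, inp₁ d i h = ρ₁ i (inp d (τ₁ i) h))
    (τ₂ : I₂ → Option I) (hτ₂ : Function.Injective τ₂) (ρ₂ : I₂ → A → A₂)
    (σ : I₂ → Option B → A₂)
    (hinp₂ : ∀ d i h, inp₂ d i h = (τ₂ i).elim (σ i (out₁ d h)) fun j => ρ₂ i (inp d j h)) :
    Computes inp out₂ fun d => 4 * t₁ d + t₂ d + 6 := by
  obtain ⟨W₁, K₁, Q₁, hW₁, hK₁, hQ₁, M₁, o₁, e₁, he₁, H₁⟩ := h₁
  obtain ⟨W₂, K₂, Q₂, hW₂, hK₂, hQ₂, M₂, o₂, e₂, he₂, H₂⟩ := h₂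
  -- Once the first machine has halted, its output tape holds only values of `e₁`, so a left inverse
  -- recovers the output.
  let σ' : I₂ → K₁ → A₂ := fun i k => σ i (Function.invFun e₁ k)
  let N := M₁.seq M₂ τ₁ ρ₁ o₁ τ₂ ρ₂ σ'
  refine ⟨_, _, _, inferInstance, inferInstance, inferInstance, N, some (Sum.inr o₂),
    fun c => (e₁ none, e₂ c), fun c c' h => he₂ (Prod.ext_iff.1 h).2, fun d => ?_⟩
  obtain ⟨hs₁, hw₁⟩ := H₁ d
  -- The clock counts up to the actual halting time `n`, which gives `1 + n + (3 * n + 5)` steps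
  -- before the second machine starts.
  obtain ⟨n, hn, heq, hlt⟩ := M₁.exists_first_halt _ hs₁
  rw [← heq] at hs₁ hw₁
  have inv₁ := (FstInv.initial M₁ M₂ τ₁ ρ₁ o₁ τ₂ ρ₂ σ' (e₁ none) (e₂ none) (inp d)).iterate
    (M₁ := M₁) (M₂ := M₂) (ρ₁ := ρ₁) (o := o₁) (τ₂ := τ₂) (ρ₂ := ρ₂) (σ := σ') hτ₁ (hinp₁ d) hlt
  have inv₂ := inv₁.cleanup (M₁ := M₁) (M₂ := M₂) (ρ₁ := ρ₁) (o := o₁) (τ₂ := τ₂) (ρ₂ := ρ₂)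
    (σ := σ') (X := inp d) hs₁
  rw [← Function.iterate_add_apply, ← Function.iterate_succ_apply] at inv₂
  have inv₃ : ∀ k, SndInv τ₂ o₁ (e₁ none) (((M₁.step (inp₁ d))^[n] (M₁.initial (e₁ none))).work o₁)
      ((M₂.step (inp₂ d))^[k] (M₂.initial (e₂ none)))
      ((N.step (inp d))^[k] ((N.step (inp d))^[(3 * n + 5 + n).succ]
        (N.initial (e₁ none, e₂ none)))) := by
    intro k
    induction k with
    | zero => exact inv₂
    | succ k ih =>
      rw [Function.iterate_succ_apply', Function.iterate_succ_apply']
      refine ih.step hτ₂ fun i h => ?_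
      rw [hinp₂, hw₁]
      simp only [σ', Function.leftInverse_invFun he₁ _]
  have inv := inv₃ (t₂ d)
  rw [← Function.iterate_add_apply] at inv
  obtain ⟨hs₂, hw₂⟩ := H₂ d
  have hst := inv.state
  rw [hs₂] at hst
  simp only
  rw [N.iterate_step_of_le (m := t₂ d + (3 * n + 5 + n).succ) _ (by omega) hst]
  refine ⟨hst, fun i => ?_⟩
  rw [inv.workSnd, hw₂]

/-! ### Output length -/

/-- One step changes at most one cell of each work tape. Consequently an output cannot be longer
than the running time. -/
lemma TM.exists_finset_work {I A W K Q : Type} (M : TM I A W K Q) (X : I → ℕ → A) (b : K)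
    (o : W) (n : ℕ) : ∃ s : Finset ℕ, s.card ≤ n ∧
      ∀ i ∉ s, ((M.step X)^[n] (M.initial b)).work o i = b := by
  classical
  induction n with
  | zero => exact ⟨∅, le_rfl, fun i _ => rfl⟩
  | succ n ih =>
    obtain ⟨s, hs, hw⟩ := ih
    rw [Function.iterate_succ_apply']
    set c := (M.step X)^[n] (M.initial b)
    by_cases hc : c.state = M.halt
    · rw [M.step_of_halted X hc]
      exact ⟨s, by omega, hw⟩
    · rw [M.step_of_not_halted X hc]
      refine ⟨insert (c.head (Sum.inr o)) s, (Finset.card_insert_le _ _).trans (by omega),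
        fun i hi => ?_⟩
      rw [Finset.mem_insert, not_or] at hi
      rw [← hw i hi.2]
      exact Function.update_of_ne hi.1 _ _

lemma Computes.length_le {D I A C : Type} {inp : D → I → ℕ → A} {y : D → List C} {t : D → ℕ}
    (h : Computes inp (fun d i => (y d)[i]?) t) (d : D) : (y d).length ≤ t d := by
  obtain ⟨W, K, Q, hW, hK, hQ, M, o, e, he, H⟩ := h
  obtain ⟨s, hs, hw⟩ := M.exists_finset_work (inp d) (e none) o (t d)
  have hsub : Finset.range (y d).length ⊆ s := by
    intro i hi
    by_contra his
    have h₁ := hw i his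
    rw [(H d).2 i] at h₁
    have h₂ := he h₁
    simp only [List.getElem?_eq_none_iff] at h₂
    have := Finset.mem_range.1 hi
    omega
  simpa using (Finset.card_le_card hsub).trans hs

/-! ### Transducers -/

/-- The output of a finite-state transducer that is started in the state `s`. -/
def transduce {S Γ C : Type} (f : S → Γ → S × Option C) : S → List Γ → List C
  | _, [] => []
  | s, a :: l => (f s a).2.toList ++ transduce f (f s a).1 l

lemma length_transduce_le {S Γ C : Type} (f : S → Γ → S × Option C) (s : S) (l : List Γ) :
    (transduce f s l).length ≤ l.length := by
  induction l generalizing s with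
  | nil => simp [transduce]
  | cons a l ih =>
    have := ih (f s a).1
    have h : (f s a).2.toList.length ≤ 1 := by cases (f s a).2 <;> simp
    simp only [transduce, List.length_append, List.length_cons]
    omega

lemma transduce_map {Γ C : Type} (c : Γ → C) (l : List Γ) :
    transduce (fun (_ : Unit) a => ((), some (c a))) () l = l.map c := by
  induction l with
  | nil => rfl
  | cons a l ih => simp [transduce, ih]

/-- The machine of a transducer; `dec` extracts its input symbol from the symbols read. -/
def TM.ofTransducer {I A S Γ C : Type} (f : S → Γ → S × Option C) (s₀ : S)
    (dec : (I → A) → Option Γ) : TM I A Unit (Option C) (Option S) where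
  start := some s₀
  halt := none
  access := ∅
  δ := fun q x k b =>
    match q, dec x with
    | some s, some a =>
      { next := some (f s a).1
        write := fun _ => (f s a).2
        move := fun t =>
          match t with
          | Sum.inl _ => Move.right
          | Sum.inr _ => if (f s a).2.isSome then Move.right else Move.stay
        idxWrite := b
        idxMove := fun _ => Move.stay }
    | _, _ => Action.keep none k b fun _ => Move.stay

/-- Induction on the unread input `rest`, with `acc` the output so far. The output head stays just
behind `acc`, so a step that emits nothing writes a blank on a blank. -/
lemma TM.ofTransducer_run {I A S Γ C : Type} (f : S → Γ → S × Option C) (s₀ : S)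
    (dec : (I → A) → Option Γ) (X : I → ℕ → A) (rest : List Γ) (n : ℕ)
    (hX : ∀ h, dec (fun i => X i (n + h)) = rest[h]?) (s : S) (acc : List C)
    (c : Cfg I Unit (Option C) (Option S)) (hs : c.state = some s)
    (hin : ∀ i, c.head (Sum.inl i) = n) (hout : c.head (Sum.inr ()) = acc.length)
    (hw : ∀ i, c.work () i = acc[i]?) :
    ((((TM.ofTransducer f s₀ dec).step X)^[rest.length + 1] c).state = none) ∧
      ∀ i, (((TM.ofTransducer f s₀ dec).step X)^[rest.length + 1] c).work () i =
        (acc ++ transduce f s rest)[i]? := by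
  set M := TM.ofTransducer f s₀ dec with hM
  have hread : dec (fun i => X i (c.head (Sum.inl i))) = rest[0]? := by
    simp only [hin]
    exact hX 0
  have hstep : M.step X c = c.perform M.access (M.action X c) :=
    M.step_of_not_halted X (by rw [hs]; exact Option.some_ne_none s)
  induction rest generalizing n s acc c with
  | nil =>
    have hact : M.action X c = Action.keep none (fun j => c.work j (c.head (Sum.inr j)))
        (fun t => decide (c.idxHead t ∈ c.idx t)) (fun _ => Move.stay) := by
      simp only [TM.action, hM, TM.ofTransducer, hs, hread]
      rfl
    rw [List.length_nil, zero_add, Function.iterate_one, hstep, hact, Cfg.perform_keep]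
    exact ⟨rfl, by simpa [transduce] using hw⟩
  | cons a rest ih =>
    rw [List.length_cons, Function.iterate_succ_apply, hstep]
    have hact : M.action X c =
        { next := some (f s a).1
          write := fun _ => (f s a).2
          move := fun t =>
            match t with
            | Sum.inl _ => Move.right
            | Sum.inr _ => if (f s a).2.isSome then Move.right else Move.stay
          idxWrite := fun t => decide (c.idxHead t ∈ c.idx t)
          idxMove := fun _ => Move.stay } := by
      simp only [TM.action, hM, TM.ofTransducer, hs, hread]
      rfl
    set c' := c.perform M.access (M.action X c) with hc'
    have hna : ∀ q, q ∉ M.access := fun q hq => hq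
    have hs' : c'.state = some (f s a).1 := by rw [hc', hact]; rfl
    have hin' : ∀ i, c'.head (Sum.inl i) = n + 1 := fun i => by
      rw [hc', hact]
      simp [Cfg.perform, hna, Move.apply, hin]
    have hX' : ∀ h, dec (fun i => X i (n + 1 + h)) = rest[h]? := fun h => by
      have := hX (h + 1)
      rw [show n + (h + 1) = n + 1 + h by ring] at this
      simpa using this
    have key := ih (n + 1) hX' (f s a).1 (acc ++ (f s a).2.toList) c' hs' hin'
      (by
        rw [hc', hact]
        cases (f s a).2 <;> simp [Cfg.perform, hna, Move.apply, hout])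
      (fun i => by
        rw [hc', hact]
        simp only [Cfg.perform, hout, Function.update_apply, hw]
        cases h : (f s a).2 with
        | none =>
          split_ifs with hi
          · simp [hi]
          · simp
        | some b =>
          simp only [Option.toList_some]
          split_ifs with hi
          · simp [hi]
          · rcases Nat.lt_or_gt_of_ne hi with hi | hi
            · rw [List.getElem?_append_left hi]
            · rw [List.getElem?_eq_none (by omega),
                List.getElem?_eq_none (by simpa using hi)])
      (by
        simp only [hin']
        exact hX' 0)
      (M.step_of_not_halted X (by rw [hs']; exact Option.some_ne_none _))
    simpa [transduce, List.append_assoc] using key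

lemma computes_transduce {D I A S Γ C : Type} [Finite S] [Finite C]
    (f : S → Γ → S × Option C) (s₀ : S) (dec : (I → A) → Option Γ) {inp : D → I → ℕ → A}
    {l : D → List Γ} (h : ∀ d j, dec (fun i => inp d i j) = (l d)[j]?) :
    Computes inp (fun d j => (transduce f s₀ (l d))[j]?) fun d => (l d).length + 1 := by
  refine ⟨Unit, Option C, Option S, inferInstance, inferInstance, inferInstance,
    TM.ofTransducer f s₀ dec, (), id, Function.injective_id, fun d => ?_⟩
  exact TM.ofTransducer_run f s₀ dec (inp d) (l d) 0 (by simpa using h d) s₀ [] _ rfl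
    (fun _ => rfl) rfl (fun i => by simp [TM.initial])

/-! ### Polynomial bounds -/

/-- Powers of `n + 2` absorb sums and constant factors, since the base is at least 2. This lemma
leads back to the form required by the definitions. -/
lemma pow_le_pow_add_const (a : ℕ) : ∃ k, 0 < k ∧ ∀ n : ℕ, (n + 2) ^ a ≤ n ^ k + k := by
  -- The summand `3 ^ a` covers `n = 0` and `n = 1`; from 2 on, `n + 2 ≤ n ^ 2` doubles the
  -- exponent.
  refine ⟨3 ^ a + 2 * a, by positivity, fun n => ?_⟩
  have h23 : 2 ^ a ≤ 3 ^ a := Nat.pow_le_pow_left (by norm_num) a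
  match n with
  | 0 => exact h23.trans ((Nat.le_add_right _ _).trans (Nat.le_add_left _ _))
  | 1 => exact (Nat.le_add_right _ _).trans (Nat.le_add_left _ _)
  | n + 2 =>
    calc (n + 2 + 2) ^ a ≤ ((n + 2) ^ 2) ^ a := Nat.pow_le_pow_left (by nlinarith) a
      _ = (n + 2) ^ (2 * a) := by rw [← pow_mul]
      _ ≤ (n + 2) ^ (3 ^ a + 2 * a) := Nat.pow_le_pow_right (by omega) (Nat.le_add_left _ _)
      _ ≤ _ := Nat.le_add_right _ _

lemma mul_pow_add_const_le (k n : ℕ) : k * n ^ k + k ≤ (n + 2) ^ (2 * k + 1) := by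
  have h₁ : n ^ k ≤ (n + 2) ^ k := Nat.pow_le_pow_left (by omega) k
  have h₂ : k ≤ (n + 2) ^ k := (Nat.lt_pow_self (by omega)).le
  have h₃ : 1 ≤ (n + 2) ^ k := Nat.one_le_pow _ _ (by omega)
  have h₄ : (n + 2) ^ (2 * k + 1) = (n + 2) ^ k * (n + 2) ^ k * (n + 2) := by ring
  rw [h₄]
  nlinarith [Nat.mul_le_mul h₂ h₁, Nat.mul_le_mul h₂ h₃,
    Nat.mul_le_mul (le_refl ((n + 2) ^ k * (n + 2) ^ k)) (show 2 ≤ n + 2 by omega)]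

lemma pow_add_const_le (k n : ℕ) : n ^ k + k ≤ (n + 2) ^ (2 * k + 1) := by
  rcases Nat.eq_zero_or_pos k with rfl | hk
  · simp
  · have := mul_pow_add_const_le k n
    have : n ^ k ≤ k * n ^ k := Nat.le_mul_of_pos_left _ hk
    omega

lemma add_pow_le_pow (a b n : ℕ) : (n + 2) ^ a + (n + 2) ^ b ≤ (n + 2) ^ (a + b + 1) := by
  have h₁ : 1 ≤ (n + 2) ^ a := Nat.one_le_pow _ _ (by omega)
  have h₂ : 1 ≤ (n + 2) ^ b := Nat.one_le_pow _ _ (by omega)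
  have h₃ : (n + 2) ^ (a + b + 1) = (n + 2) ^ a * (n + 2) ^ b * (n + 2) := by ring
  rw [h₃]
  nlinarith [Nat.mul_le_mul h₁ (le_refl ((n + 2) ^ b)), Nat.mul_le_mul (le_refl ((n + 2) ^ a)) h₂,
    Nat.mul_le_mul (le_refl ((n + 2) ^ a * (n + 2) ^ b)) (show 2 ≤ n + 2 by omega)]

lemma const_le_pow (c n : ℕ) : c ≤ (n + 2) ^ c := (Nat.lt_pow_self (by omega)).le

lemma const_mul_pow_le (c a n : ℕ) : c * (n + 2) ^ a ≤ (n + 2) ^ (c + a) := by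
  rw [pow_add]
  exact Nat.mul_le_mul_right _ (const_le_pow c n)

/-! ### Polynomial time -/

/-- `f` is computed in polynomial time by some machine. -/
def PolyComputes {A B : Type} (f : List A → List B) : Prop :=
  ∃ a : ℕ, Computes (fun (x : List A) (_ : Fin 1) h => x[h]?) (fun x h => (f x)[h]?)
    fun x => (x.length + 2) ^ a

lemma PTIMEComputable.polyComputes {A B : Type} [Finite B] {f : List A → List B}
    (h : PTIMEComputable f) : PolyComputes f := by
  obtain ⟨M, k, hM⟩ := h
  refine ⟨2 * k + 1, Computes.mono ?_ fun x => pow_add_const_le k x.length⟩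
  simpa using M.computes hM

lemma PolyComputes.ptimeComputable {A B : Type} {f : List A → List B}
    (h : PolyComputes f) : PTIMEComputable f := by
  obtain ⟨a, ha⟩ := h
  obtain ⟨k, -, hk⟩ := pow_le_pow_add_const a
  have h' : Computes (fun (x : List A) (i : Fin 1) h => (![x] i)[h]?) (fun x h => (f x)[h]?)
      fun x => x.length ^ k + k := by
    simpa using ha.mono fun x => hk x.length
  obtain ⟨M, hM⟩ := h'.exists_ratm
  exact ⟨M, k, hM⟩

lemma polyComputes_transduce {A S C : Type} [Finite S] [Finite C] (f : S → A → S × Option C)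
    (s : S) : PolyComputes fun l => transduce f s l :=
  ⟨1, (computes_transduce f s (fun a => a 0) fun _ _ => rfl).mono fun x => by simp⟩

lemma PolyComputes.comp {A B C : Type} {g : List B → List C} {f : List A → List B}
    (hg : PolyComputes g) (hf : PolyComputes f) : PolyComputes fun x => g (f x) := by
  obtain ⟨a, ha⟩ := hf
  obtain ⟨b, hb⟩ := hg
  have key := ha.seq (inp := fun (x : List A) (_ : Fin 1) h => x[h]?) (hb.comap f)
    id Function.injective_id (fun _ => id) (fun _ _ _ => rfl) (fun _ => none)
    (Function.injective_of_subsingleton _) (fun _ _ => none) (fun _ => id) (fun _ _ _ => rfl)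
  refine ⟨(4 + a + (a + 1 + 1) * b + 1) + 6 + 1, key.mono fun x => ?_⟩
  have h₁ : (f x).length + 2 ≤ (x.length + 2) ^ (a + 1 + 1) :=
    (Nat.add_le_add (ha.length_le x) (by simp)).trans (add_pow_le_pow a 1 x.length)
  have h₂ : ((f x).length + 2) ^ b ≤ (x.length + 2) ^ ((a + 1 + 1) * b) := by
    rw [pow_mul]
    exact Nat.pow_le_pow_left h₁ b
  calc 4 * (x.length + 2) ^ a + ((f x).length + 2) ^ b + 6
      ≤ (x.length + 2) ^ (4 + a) + (x.length + 2) ^ ((a + 1 + 1) * b) + (x.length + 2) ^ 6 :=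
        Nat.add_le_add (Nat.add_le_add (const_mul_pow_le _ _ _) h₂) (const_le_pow _ _)
    _ ≤ (x.length + 2) ^ (4 + a + (a + 1 + 1) * b + 1) + (x.length + 2) ^ 6 :=
        Nat.add_le_add_right (add_pow_le_pow _ _ _) _
    _ ≤ _ := add_pow_le_pow _ _ _

/-- Two strings as one string over pairs of symbols or blanks. -/
def zipAll {U V : Type} (u : List U) (v : List V) : List (Option U × Option V) :=
  List.zipWithAll Prod.mk u v

lemma getElem?_zipAll {U V : Type} (u : List U) (v : List V) (i : ℕ) :
    (zipAll u v)[i]? = if u[i]? = none ∧ v[i]? = none then none else some (u[i]?, v[i]?) := by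
  rw [zipAll, List.getElem?_zipWithAll]
  cases u[i]? <;> cases v[i]? <;> simp

lemma length_zipAll_le {U V : Type} (u : List U) (v : List V) :
    (zipAll u v).length ≤ u.length + v.length := by
  have h : (zipAll u v)[u.length + v.length]? = none := by
    rw [getElem?_zipAll, if_pos]
    exact ⟨List.getElem?_eq_none (by omega), List.getElem?_eq_none (by omega)⟩
  exact List.getElem?_eq_none_iff.1 h

-- A sequential composition passes on a single output. So `g` and the zipping machine form an inner
-- composition that has `f x` on an input tape, and an outer one supplies `f x`. Tapes with
-- different alphabets share one type by means of pairs with a dummy component.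
open Classical in
lemma PolyComputes.zipAll {A U V C : Type} [Finite C] {f : List A → List U}
    {g : List A → List V} (hf : PolyComputes f) (hg : PolyComputes g)
    (c : Option U × Option V → C) :
    PolyComputes fun x => (zipAll (f x) (g x)).map c := by
  obtain ⟨a, ha⟩ := hf
  obtain ⟨b, hb⟩ := hg
  have hzip : Computes
      (fun (x : List A) (i : Bool) h => if i then (none, (g x)[h]?) else ((f x)[h]?, none))
      (fun x h => ((PsT.zipAll (f x) (g x)).map c)[h]?)
      (fun x => (PsT.zipAll (f x) (g x)).length + 1) := by
    simp only [← transduce_map]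
    refine computes_transduce _ _ (fun s : Bool → Option U × Option V =>
      if (s false).1 = none ∧ (s true).2 = none then none
      else some ((s false).1, (s true).2)) fun x j => ?_
    simp [getElem?_zipAll]
  have hinner : Computes
      (fun (x : List A) (i : Bool) h => if i then (none, (f x)[h]?) else (x[h]?, none))
      (fun x h => ((PsT.zipAll (f x) (g x)).map c)[h]?) _ :=
    hb.seq hzip (fun _ => false) (Function.injective_of_subsingleton _)
      (fun _ (s : Option A × Option U) => s.1) (fun _ _ _ => rfl)
      (fun i => if i then none else some true) (by intro i j; cases i <;> cases j <;> simp)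
      (fun _ s => (s.2, none)) (fun _ v => (none, v)) (by intro x i h; cases i <;> simp)
  have houter := ha.seq (inp := fun (x : List A) (_ : Fin 1) h => x[h]?) hinner id
    Function.injective_id (fun _ => id) (fun _ _ _ => rfl)
    (fun i => if i then none else some 0) (by intro i j; cases i <;> cases j <;> simp)
    (fun _ s => (s, none)) (fun _ u => (none, u)) (by intro x i h; cases i <;> simp)
  refine ⟨(5 + a + (5 + b) + 1) + 13 + 1, houter.mono fun x => ?_⟩
  have h₁ := length_zipAll_le (f x) (g x)
  have h₂ := ha.length_le x
  have h₃ := hb.length_le x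
  calc 4 * (x.length + 2) ^ a + (4 * (x.length + 2) ^ b +
        ((PsT.zipAll (f x) (g x)).length + 1) + 6) + 6
      ≤ 5 * (x.length + 2) ^ a + 5 * (x.length + 2) ^ b + 13 := by omega
    _ ≤ (x.length + 2) ^ (5 + a) + (x.length + 2) ^ (5 + b) + (x.length + 2) ^ 13 :=
        Nat.add_le_add (Nat.add_le_add (const_mul_pow_le _ _ _) (const_mul_pow_le _ _ _))
          (const_le_pow _ _)
    _ ≤ (x.length + 2) ^ (5 + a + (5 + b) + 1) + (x.length + 2) ^ 13 :=
        Nat.add_le_add_right (add_pow_le_pow _ _ _) _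
    _ ≤ _ := add_pow_le_pow _ _ _

/-! ### Composition of PsT computable functions -/

/-- The maximum is attained at some `m ≤ n`. Beyond the threshold `N`, `T m ≤ c * m ≤ c * n`; below
it, `T m` is at most a constant, which `c * n` eventually exceeds. -/
lemma isLittleO_running_max {T : ℕ → ℕ}
    (hT : (fun n => (T n : ℝ)) =o[Filter.atTop] (fun n : ℕ => (n : ℝ))) :
    (fun n => (((Finset.range (n + 1)).sup T : ℕ) : ℝ)) =o[Filter.atTop]
      (fun n : ℕ => (n : ℝ)) := by
  rw [Asymptotics.isLittleO_iff] at hT ⊢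
  intro c hc
  obtain ⟨N, hN⟩ := Filter.eventually_atTop.1 (hT hc)
  set B := (Finset.range N).sup T
  obtain ⟨N', hN'⟩ := exists_nat_gt ((B : ℝ) / c)
  refine Filter.eventually_atTop.2 ⟨N', fun n hn => ?_⟩
  have hB : (B : ℝ) ≤ c * n := by
    rw [div_lt_iff₀ hc] at hN'
    have : (N' : ℝ) ≤ n := by exact_mod_cast hn
    nlinarith
  have hcn : 0 ≤ c * n := by positivity
  simp only [Real.norm_natCast]
  obtain ⟨m, hm, hmax⟩ := Finset.exists_mem_eq_sup (Finset.range (n + 1)) ⟨0, by simp⟩ T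
  rw [hmax]
  by_cases hmN : m < N
  · exact le_trans (by exact_mod_cast Finset.le_sup (f := T) (Finset.mem_range.2 hmN)) hB
  · have h₁ := hN m (by omega)
    simp only [Real.norm_natCast] at h₁
    have h₂ : (m : ℝ) ≤ n := by
      have := Finset.mem_range.1 hm
      exact_mod_cast Nat.lt_succ_iff.1 this
    exact h₁.trans (mul_le_mul_of_nonneg_left h₂ hc.le)

theorem PsTComputable.comp {α : Type} [Finite α] {g g' : List α → List α → List α}
    (hg : PsTComputable g) (hg' : PsTComputable g') {p p' : List α → List α}
    (hp : PolyComputes p) (hp' : PolyComputes p') (hpl : ∀ x, (p x).length ≤ x.length)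
    (hpl' : ∀ x, (p' x).length ≤ x.length) :
    PsTComputable fun x y => g' (p' x) (g (p x) y) := by
  obtain ⟨r, Pre, M, T, hPre, hT, hM⟩ := hg
  obtain ⟨r', Pre', M', T', hPre', hT', hM'⟩ := hg'
  let U := α ⊕ Fin r
  let V := α ⊕ Fin r'
  -- Both input tapes must have one alphabet: pairs of track symbols are coded by the auxiliary
  -- symbols, and the problem part keeps the letters of `α`.
  obtain ⟨s, ⟨ε⟩⟩ := Finite.exists_equiv_fin (Option U × Option V)
  let code : Option U × Option V → α ⊕ Fin s := fun q => Sum.inr (ε q)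
  let track : Option (α ⊕ Fin s) → Option U × Option V := fun q =>
    match q with
    | some (Sum.inr j) => ε.symm j
    | _ => (none, none)
  let word : Option (α ⊕ Fin s) → Option U := fun q =>
    match q with
    | some (Sum.inl a) => some (Sum.inl a)
    | _ => none
  let Q : List α → List (α ⊕ Fin s) := fun x => (zipAll (Pre (p x)) (Pre' (p' x))).map code
  have htrack : ∀ x (j : ℕ), track (Q x)[j]? = ((Pre (p x))[j]?, (Pre' (p' x))[j]?) := by
    intro x j
    simp only [Q, List.getElem?_map, getElem?_zipAll]
    cases h₁ : (Pre (p x))[j]? <;> cases h₂ : (Pre' (p' x))[j]? <;> simp [track, code]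
  have hword : ∀ (y : List α) (j : ℕ),
      word (y.map (Sum.inl : α → α ⊕ Fin s))[j]? = (y.map (Sum.inl : α → U))[j]? := by
    intro y j
    simp only [List.getElem?_map]
    cases y[j]? <;> rfl
  have h₁ := M.computes (D := List α × List α) fun d => hM (p d.1) d.2
  have h₂ := M'.computes (D := List α × List α) fun d => hM' (p' d.1) (g (p d.1) d.2)
  have key : Computes
      (fun (d : List α × List α) (i : Fin 2) j => (![Q d.1, d.2.map Sum.inl] i)[j]?) _ _ :=
    h₁.seq h₂ id Function.injective_id (fun i q => if i = 0 then (track q).1 else word q)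
      (by
        intro d i j
        fin_cases i
        · simp [htrack]
        · exact (hword d.2 j).symm)
      -- The second machine finds its data on the second track of tape 0 and its problem part on the
      -- output tape of the first.
      (fun i => if i = 0 then some 0 else none)
      (by intro i j; fin_cases i <;> fin_cases j <;> simp)
      (fun _ q => (track q).2) (fun _ => Option.map Sum.inl)
      (by intro d i j; fin_cases i <;> simp [htrack])
  let S : (ℕ → ℕ) → ℕ → ℕ := fun T n => (Finset.range (n + 1)).sup T
  have hS : ∀ (T : ℕ → ℕ) {m n : ℕ}, m ≤ n → T m ≤ S T n := fun T m n hmn =>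
    Finset.le_sup (f := T) (Finset.mem_range.2 (by omega))
  have key' := key.mono (t' := fun d => 4 * S T d.1.length + S T' d.1.length + 6) fun d => by
    have h₁ := hS T (hpl d.1)
    have h₂ := hS T' (hpl' d.1)
    omega
  obtain ⟨N, hN⟩ := key'.exists_ratm
  refine ⟨s, Q, N, fun n => 4 * S T n + S T' n + 6, ?_, ?_, fun x y => hN (x, y)⟩
  · exact ((hPre.polyComputes.comp hp).zipAll (hPre'.polyComputes.comp hp')
      code).ptimeComputable
  · have h₆ : (fun _ : ℕ => (6 : ℝ)) =o[Filter.atTop] (fun n : ℕ => (n : ℝ)) :=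
      (Asymptotics.isLittleO_const_id_atTop (6 : ℝ)).comp_tendsto tendsto_natCast_atTop_atTop
    have := (((isLittleO_running_max hT).const_mul_left 4).add (isLittleO_running_max hT')).add h₆
    simpa [S] using this

/-! ### Pairs of strings as strings -/

section Pairing

variable {α : Type}

/-- Two strings as one string. Every position gives four symbols: for each string one of the
symbols `yes` and `no`, which says whether the string has this position, and its symbol there. -/
def pairCode (yes no : α) : List α → List α → List α
  | [], [] => []
  | a :: u, [] => yes :: a :: no :: yes :: pairCode yes no u []
  | [], b :: v => no :: yes :: yes :: b :: pairCode yes no [] v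
  | a :: u, b :: v => yes :: a :: yes :: b :: pairCode yes no u v

open Classical in
/-- One step in decoding a pair, for a position modulo four and the last flag. -/
noncomputable def unpairStep (yes : α) (s : Fin 4 × Bool) (a : α) :
    (Fin 4 × Bool) × Option α :=
  ((s.1 + 1, if s.1 = 0 then decide (a = yes) else s.2),
    if s.1 = 1 ∧ s.2 = true then some a else none)

/-- The flag is set at residue 0 before it is consulted at residue 1, so its initial value is
arbitrary; the induction over blocks needs this freedom. -/
lemma transduce_unpairStep_fst {yes no : α} (h : no ≠ yes) (u v : List α) (b : Bool) :
    transduce (unpairStep yes) (0, b) (pairCode yes no u v) = u := by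
  fun_induction pairCode yes no u v generalizing b <;>
    simp_all [transduce, unpairStep]

/-- Starting at residue 2 exchanges the roles of the two halves of every block. -/
lemma transduce_unpairStep_snd {yes no : α} (h : no ≠ yes) (u v : List α) (b : Bool) :
    transduce (unpairStep yes) (2, b) (pairCode yes no u v) = v := by
  fun_induction pairCode yes no u v generalizing b <;>
    simp_all [transduce, unpairStep]

lemma length_pairCode_le (yes no : α) (u v : List α) :
    (pairCode yes no u v).length ≤ 4 * (u.length + v.length) := by
  fun_induction pairCode yes no u v <;> simp_all <;> omega

end Pairing

/-! ### Execution of PRAM programs -/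

section Instructions

variable (act : Set ℕ) (σ : PRAMState)

open Classical in
lemma PRAMState.setReg_reg (r : ℕ) (v : ℕ → ℕ) (i r' : ℕ) :
    (σ.setReg act r v).reg i r' = if i ∈ act ∧ r' = r then v i else σ.reg i r' := by
  by_cases h : i ∈ act <;> simp [PRAMState.setReg, h, Function.update_apply]

open Classical in
lemma reg_const (r n i r' : ℕ) : (PRAMInstr.apply act σ (.const r n)).reg i r' =
    if i ∈ act ∧ r' = r then n else σ.reg i r' := σ.setReg_reg act r _ i r'

open Classical in
lemma reg_pid (r i r' : ℕ) : (PRAMInstr.apply act σ (.pid r)).reg i r' =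
    if i ∈ act ∧ r' = r then i else σ.reg i r' := σ.setReg_reg act r _ i r'

open Classical in
lemma reg_add (r s t i r' : ℕ) : (PRAMInstr.apply act σ (.add r s t)).reg i r' =
    if i ∈ act ∧ r' = r then σ.reg i s + σ.reg i t else σ.reg i r' := σ.setReg_reg act r _ i r'

open Classical in
lemma reg_sub (r s t i r' : ℕ) : (PRAMInstr.apply act σ (.sub r s t)).reg i r' =
    if i ∈ act ∧ r' = r then σ.reg i s - σ.reg i t else σ.reg i r' := σ.setReg_reg act r _ i r'

open Classical in
lemma reg_half (r s i r' : ℕ) : (PRAMInstr.apply act σ (.half r s)).reg i r' =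
    if i ∈ act ∧ r' = r then σ.reg i s / 2 else σ.reg i r' := σ.setReg_reg act r _ i r'

open Classical in
lemma reg_load (r a s i r' : ℕ) : (PRAMInstr.apply act σ (.load r a s)).reg i r' =
    if i ∈ act ∧ r' = r then σ.mem a (σ.reg i s) else σ.reg i r' := σ.setReg_reg act r _ i r'

lemma reg_store (a s t : ℕ) : (PRAMInstr.apply act σ (.store a s t)).reg = σ.reg := rfl

lemma mem_const (r n : ℕ) : (PRAMInstr.apply act σ (.const r n)).mem = σ.mem := rfl

lemma mem_pid (r : ℕ) : (PRAMInstr.apply act σ (.pid r)).mem = σ.mem := rfl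

lemma mem_add (r s t : ℕ) : (PRAMInstr.apply act σ (.add r s t)).mem = σ.mem := rfl

lemma mem_load (r a s : ℕ) : (PRAMInstr.apply act σ (.load r a s)).mem = σ.mem := rfl

lemma mem_store_of_ne {a b : ℕ} (s t : ℕ) (h : b ≠ a) :
    (PRAMInstr.apply act σ (.store a s t)).mem b = σ.mem b :=
  Function.update_of_ne h _ _

variable {act σ}

lemma mem_store_of_hit {a s t i j : ℕ} (hi : i ∈ act) (hij : σ.reg i s = j)
    (hmin : ∀ i' ∈ act, σ.reg i' s = j → i ≤ i') :
    (PRAMInstr.apply act σ (.store a s t)).mem a j = σ.reg i t := by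
  have h : sInf {i | i ∈ act ∧ σ.reg i s = j} = i :=
    le_antisymm (Nat.sInf_le ⟨hi, hij⟩) (le_csInf ⟨i, hi, hij⟩ fun i' h => hmin i' h.1 h.2)
  simp only [PRAMInstr.apply, Function.update_self]
  rw [if_pos ⟨i, hi, hij⟩, h]

lemma mem_store_of_miss {a s t j : ℕ} (h : ∀ i ∈ act, σ.reg i s ≠ j) :
    (PRAMInstr.apply act σ (.store a s t)).mem a j = σ.mem a j := by
  simp only [PRAMInstr.apply, Function.update_self]
  exact if_neg fun ⟨i, hi, hij⟩ => h i hi hij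

open Classical in
/-- A store at addresses of the form `4 * i + k`. -/
lemma mem_store_mul_four_add {a s t k : ℕ} (hk : k < 4) (h : ∀ i ∈ act, σ.reg i s = 4 * i + k)
    {i d : ℕ} (hd : d < 4) :
    (PRAMInstr.apply act σ (.store a s t)).mem a (4 * i + d) =
      if i ∈ act ∧ d = k then σ.reg i t else σ.mem a (4 * i + d) := by
  split_ifs with hi
  · exact mem_store_of_hit hi.1 (by rw [h i hi.1, hi.2])
      fun i' hi' h' => by rw [h i' hi'] at h'; omega
  · refine mem_store_of_miss fun i' hi' h' => hi ?_
    rw [h i' hi'] at h'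
    obtain rfl : i' = i := by omega
    exact ⟨hi', by omega⟩

end Instructions

/-- A sequence of instructions. -/
def PRAMProg.block : PRAMInstr → List PRAMInstr → PRAMProg
  | i, [] => .instr i
  | i, j :: l => .seq (.instr i) (PRAMProg.block j l)

lemma PRAMExec.block (act : Set ℕ) (i : PRAMInstr) (l : List PRAMInstr) (σ : PRAMState) :
    PRAMExec (.block i l) act σ (l.length + 1) ((i :: l).foldl (PRAMInstr.apply act) σ) := by
  induction l generalizing i σ with
  | nil => exact .instr i act σ
  | cons j l ih =>
    have h := PRAMExec.seq (.instr i act σ) (ih j (PRAMInstr.apply act σ i))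
    rw [add_comm] at h
    exact h

lemma PRAMExec.cast {p : PRAMProg} {act act' : Set ℕ} {σ σ' : PRAMState} {t t' : ℕ}
    (h : PRAMExec p act σ t σ') (hact : act = act') (ht : t = t') :
    PRAMExec p act' σ t' σ' := by
  subst hact ht
  exact h

/-! ### Renaming registers and arrays -/

/-- An instruction with its registers renamed by `φ` and its arrays renamed by `ψ`. -/
def PRAMInstr.rename (φ ψ : ℕ → ℕ) : PRAMInstr → PRAMInstr
  | const r n => const (φ r) n
  | pid r => pid (φ r)
  | add r s t => add (φ r) (φ s) (φ t)
  | sub r s t => sub (φ r) (φ s) (φ t)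
  | half r s => half (φ r) (φ s)
  | load r a s => load (φ r) (ψ a) (φ s)
  | store a s t => store (ψ a) (φ s) (φ t)

/-- A program with its registers renamed by `φ` and its arrays renamed by `ψ`. -/
def PRAMProg.rename (φ ψ : ℕ → ℕ) : PRAMProg → PRAMProg
  | instr i => instr (i.rename φ ψ)
  | seq p q => seq (p.rename φ ψ) (q.rename φ ψ)
  | ite r p q => ite (φ r) (p.rename φ ψ) (q.rename φ ψ)
  | loop r p => loop (φ r) (p.rename φ ψ)

/-- The part of a state that is visible through a renaming. -/
def PRAMState.pull (φ ψ : ℕ → ℕ) (τ : PRAMState) : PRAMState where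
  reg := fun i r => τ.reg i (φ r)
  mem := fun a => τ.mem (ψ a)

/-- Two states agree on the registers and arrays outside the range of a renaming. -/
def PRAMState.AgreeOff (φ ψ : ℕ → ℕ) (τ τ' : PRAMState) : Prop :=
  (∀ i r, (∀ r', r ≠ φ r') → τ'.reg i r = τ.reg i r) ∧
    ∀ a, (∀ a', a ≠ ψ a') → τ'.mem a = τ.mem a

section Rename

variable {φ ψ : ℕ → ℕ}

lemma PRAMState.AgreeOff.refl (τ : PRAMState) : τ.AgreeOff φ ψ τ :=
  ⟨fun _ _ _ => rfl, fun _ _ => rfl⟩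

lemma PRAMState.AgreeOff.trans {τ τ' τ'' : PRAMState} (h : τ.AgreeOff φ ψ τ')
    (h' : τ'.AgreeOff φ ψ τ'') : τ.AgreeOff φ ψ τ'' :=
  ⟨fun i r hr => (h'.1 i r hr).trans (h.1 i r hr), fun a ha => (h'.2 a ha).trans (h.2 a ha)⟩

lemma PRAMState.pull_setReg (hφ : Function.Injective φ) (τ : PRAMState) (act : Set ℕ) (r : ℕ)
    (v : ℕ → ℕ) : (τ.setReg act (φ r) v).pull φ ψ = (τ.pull φ ψ).setReg act r v := by
  classical
  simp only [PRAMState.pull, PRAMState.setReg, PRAMState.mk.injEq, and_true]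
  funext i r'
  by_cases h : i ∈ act <;> simp [h, Function.update_apply, hφ.eq_iff]

lemma PRAMState.agreeOff_setReg (τ : PRAMState) (act : Set ℕ) (r : ℕ) (v : ℕ → ℕ) :
    τ.AgreeOff φ ψ (τ.setReg act (φ r) v) := by
  classical
  refine ⟨fun i r' hr => ?_, fun _ _ => rfl⟩
  rw [PRAMState.setReg_reg, if_neg fun h => hr r h.2]

lemma PRAMInstr.apply_rename (hφ : Function.Injective φ) (hψ : Function.Injective ψ)
    (act : Set ℕ) (τ : PRAMState) (i : PRAMInstr) :
    (PRAMInstr.apply act τ (i.rename φ ψ)).pull φ ψ = PRAMInstr.apply act (τ.pull φ ψ) i ∧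
      τ.AgreeOff φ ψ (PRAMInstr.apply act τ (i.rename φ ψ)) := by
  cases i with
  | store a s t =>
    refine ⟨?_, fun _ _ _ => rfl, fun b hb => mem_store_of_ne act τ _ _ (hb a)⟩
    simp only [PRAMInstr.rename, PRAMInstr.apply, PRAMState.pull, PRAMState.mk.injEq, true_and]
    funext b
    by_cases hb : b = a
    · subst hb
      rw [Function.update_self, Function.update_self]
      congr
    · rw [Function.update_of_ne hb, Function.update_of_ne (hψ.ne hb)]
  | _ => exact ⟨PRAMState.pull_setReg hφ _ _ _ _, PRAMState.agreeOff_setReg _ _ _ _⟩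

/-- Tests and addresses depend only on what is visible through the renaming, so the two executions
agree step by step, with the same active processors and the same time. -/
lemma PRAMExec.rename (hφ : Function.Injective φ) (hψ : Function.Injective ψ)
    {p : PRAMProg} {act : Set ℕ} {σ σ' : PRAMState} {t : ℕ} (h : PRAMExec p act σ t σ') :
    ∀ τ : PRAMState, τ.pull φ ψ = σ →
      ∃ τ', PRAMExec (p.rename φ ψ) act τ t τ' ∧ τ'.pull φ ψ = σ' ∧ τ.AgreeOff φ ψ τ' := by
  induction h with
  | instr i act σ =>
    rintro τ rfl
    obtain ⟨h₁, h₂⟩ := PRAMInstr.apply_rename hφ hψ act τ i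
    exact ⟨_, .instr _ _ _, h₁, h₂⟩
  | seq _ _ ih₁ ih₂ =>
    intro τ hτ
    obtain ⟨τ₁, e₁, p₁, a₁⟩ := ih₁ τ hτ
    obtain ⟨τ₂, e₂, p₂, a₂⟩ := ih₂ τ₁ p₁
    exact ⟨τ₂, .seq e₁ e₂, p₂, a₁.trans a₂⟩
  | ite _ _ ih₁ ih₂ =>
    rintro τ rfl
    obtain ⟨τ₁, e₁, p₁, a₁⟩ := ih₁ τ rfl
    obtain ⟨τ₂, e₂, p₂, a₂⟩ := ih₂ τ₁ p₁
    exact ⟨τ₂, .ite e₁ e₂, p₂, a₁.trans a₂⟩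
  | loop_stop h =>
    rintro τ rfl
    exact ⟨τ, PRAMExec.loop_stop h, rfl, .refl τ⟩
  | loop_step h _ _ ih₁ ih₂ =>
    rintro τ rfl
    obtain ⟨τ₁, e₁, p₁, a₁⟩ := ih₁ τ rfl
    obtain ⟨τ₂, e₂, p₂, a₂⟩ := ih₂ τ₁ p₁
    exact ⟨τ₂, .loop_step h e₁ e₂, p₂, a₁.trans a₂⟩

end Rename

/-! ### Arithmetic -/

section Arithmetic

variable (q : ℕ → ℕ)

/-- The body of the loop of `mulProg`. -/
def mulBody : PRAMProg :=
  .seq (.block (.half (q 3) (q 1)) [.add (q 4) (q 3) (q 3), .sub (q 5) (q 1) (q 4)])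
    (.seq (.ite (q 5) (.instr (.add (q 2) (q 2) (q 0))) (.instr (.const (q 6) 0)))
      (.block (.add (q 0) (q 0) (q 0)) [.add (q 1) (q 3) (q 8)]))

/-- Adds the product of `q 0` and `q 1` to `q 2`; the registers `q 3`, …, `q 6` are auxiliary,
and `q 8` holds zero. -/
def mulProg : PRAMProg := .loop (q 1) (mulBody q)

variable {q}

/-- Subtracting twice `B / 2` from `B` leaves the parity, which decides whether `A` is added. Adding
the zero register `q 8` copies a register; the other branch is a dummy assignment. -/
lemma mulBody_exec (hq : Function.Injective q) {act : Set ℕ} {σ : PRAMState} {A B C : ℕ}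
    (hA : ∀ i ∈ act, σ.reg i (q 0) = A) (hB : ∀ i ∈ act, σ.reg i (q 1) = B)
    (hC : ∀ i ∈ act, σ.reg i (q 2) = C) (h₀ : ∀ i ∈ act, σ.reg i (q 8) = 0) :
    ∃ σ', PRAMExec (mulBody q) act σ 8 σ' ∧ σ'.mem = σ.mem ∧
      (∀ i ∈ act, σ'.reg i (q 0) = A + A) ∧ (∀ i ∈ act, σ'.reg i (q 1) = B / 2) ∧
      (∀ i ∈ act, σ'.reg i (q 2) = C + B % 2 * A) ∧
      ∀ i r, (∀ j < 7, r ≠ q j) → σ'.reg i r = σ.reg i r := by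
  refine ⟨_, (PRAMExec.seq (.block _ _ _ _) (.seq (.ite (.instr _ _ _) (.instr _ _ _))
    (.block _ _ _ _))).cast rfl rfl, ?_, ?_, ?_, ?_, ?_⟩
  · rfl
  · intro i hi
    simp [reg_add, reg_sub, reg_half, reg_const, hi, hq.eq_iff, hA i hi]
  · intro i hi
    simp [reg_add, reg_sub, reg_half, reg_const, hi, hq.eq_iff, hB i hi, h₀ i hi]
  · intro i hi
    simp [reg_add, reg_sub, reg_half, reg_const, hi, hq.eq_iff, hA i hi, hB i hi, hC i hi]
    rcases Nat.mod_two_eq_zero_or_one B with h | h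
    · rw [h, if_pos (by omega), zero_mul, add_zero]
    · rw [h, if_neg (by omega), one_mul]
  · intro i r hr
    simp [reg_add, reg_sub, reg_half, reg_const, hr]

/-- Binary multiplication: each round preserves the value of `C + A * B` while halving `B`, and
costs 8 steps and a test. All active processors hold the same `B`, so none drops out early. Without
active processors the loop would stop at once and the exact time would be wrong. -/
lemma mulProg_exec (hq : Function.Injective q) {act : Set ℕ} (hact : act.Nonempty) (B : ℕ) :
    ∀ {σ : PRAMState} {A C : ℕ},
      (∀ i ∈ act, σ.reg i (q 0) = A) → (∀ i ∈ act, σ.reg i (q 1) = B) →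
      (∀ i ∈ act, σ.reg i (q 2) = C) → (∀ i ∈ act, σ.reg i (q 8) = 0) →
      ∃ σ', PRAMExec (mulProg q) act σ (9 * Nat.size B + 1) σ' ∧ σ'.mem = σ.mem ∧
        (∀ i ∈ act, σ'.reg i (q 2) = C + A * B) ∧
        ∀ i r, (∀ j < 7, r ≠ q j) → σ'.reg i r = σ.reg i r := by
  induction B using Nat.strong_induction_on with
  | _ B ih =>
    intro σ A C hA hB hC h₀
    rcases Nat.eq_zero_or_pos B with rfl | hpos
    · refine ⟨σ, PRAMExec.loop_stop hB, rfl, fun i hi => ?_, fun _ _ _ => rfl⟩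
      rw [hC i hi, mul_zero, add_zero]
    obtain ⟨σ₁, e₁, m₁, a₁, b₁, c₁, f₁⟩ := mulBody_exec hq hA hB hC h₀
    obtain ⟨σ₂, e₂, m₂, c₂, f₂⟩ := ih (B / 2) (by omega) a₁ b₁ c₁ fun i hi => by
      rw [f₁ i _ fun j hj h => by have := hq h; omega, h₀ i hi]
    have hset : act = {i | i ∈ act ∧ σ.reg i (q 1) ≠ 0} := by
      ext i
      simp only [Set.mem_ofPred_eq, iff_self_and]
      intro hi
      rw [hB i hi]
      omega
    obtain ⟨i₀, hi₀⟩ := hact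
    have hsize : Nat.size B = Nat.size (B / 2) + 1 := by
      have hb := Nat.bit_bodd_div2 B
      conv_lhs => rw [← hb]
      rw [Nat.size_bit (by rw [hb]; omega), Nat.div2_val]
    refine ⟨σ₂, (PRAMExec.loop_step (act := act) ⟨i₀, hi₀, by rw [hB i₀ hi₀]; omega⟩
      (e₁.cast hset rfl) (e₂.cast hset rfl)).cast rfl (by rw [hsize]; ring), m₂.trans m₁,
      fun i hi => ?_, fun i r hr => (f₂ i r hr).trans (f₁ i r hr)⟩
    rw [c₂ i hi]
    have := Nat.div_add_mod B 2
    calc C + B % 2 * A + (A + A) * (B / 2) = C + A * (2 * (B / 2) + B % 2) := by ring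
      _ = _ := by rw [this]

variable (q) in
/-- Computes the `k`-th power of `q 9` in `q 7`. -/
def powProg : ℕ → PRAMProg
  | 0 => .instr (.const (q 7) 1)
  | k + 1 => .seq (powProg k) (.seq
      (.block (.add (q 0) (q 9) (q 8)) [.add (q 1) (q 7) (q 8), .const (q 2) 0])
      (.seq (mulProg q) (.instr (.add (q 7) (q 2) (q 8)))))

lemma powProg_exec (hq : Function.Injective q) {act : Set ℕ} (hact : act.Nonempty) (k : ℕ)
    {σ : PRAMState} {n : ℕ} (hn : ∀ i ∈ act, σ.reg i (q 9) = n)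
    (h₀ : ∀ i ∈ act, σ.reg i (q 8) = 0) :
    ∃ t σ', PRAMExec (powProg q k) act σ t σ' ∧ t ≤ 1 + k * (9 * k * Nat.size n + 14) ∧
      σ'.mem = σ.mem ∧ (∀ i ∈ act, σ'.reg i (q 7) = n ^ k) ∧
      ∀ i r, (∀ j < 8, r ≠ q j) → σ'.reg i r = σ.reg i r := by
  induction k with
  | zero =>
    refine ⟨_, _, .instr _ _ _, by simp, rfl, fun i hi => ?_, fun i r hr => ?_⟩
    · simp [reg_const, hi]
    · simp [reg_const, hr]
  | succ k ih =>
    obtain ⟨t₁, σ₁, e₁, ht₁, m₁, p₁, f₁⟩ := ih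
    set σ₂ := [PRAMInstr.add (q 0) (q 9) (q 8), .add (q 1) (q 7) (q 8), .const (q 2) 0].foldl
      (PRAMInstr.apply act) σ₁ with hσ₂
    have e₂ : PRAMExec (.block (.add (q 0) (q 9) (q 8)) [.add (q 1) (q 7) (q 8),
        .const (q 2) 0]) act σ₁ 3 σ₂ := .block _ _ _ _
    have hz : ∀ i ∈ act, σ₁.reg i (q 8) = 0 := fun i hi => by
      rw [f₁ i _ fun j hj h => by have := hq h; omega, h₀ i hi]
    have hn₁ : ∀ i ∈ act, σ₁.reg i (q 9) = n := fun i hi => by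
      rw [f₁ i _ fun j hj h => by have := hq h; omega, hn i hi]
    have f₂ : ∀ i r, (∀ j < 8, r ≠ q j) → σ₂.reg i r = σ₁.reg i r := fun i r hr => by
      simp [hσ₂, reg_add, reg_const, hr]
    obtain ⟨σ₃, e₃, m₃, c₃, f₃⟩ := mulProg_exec hq hact (n ^ k) (σ := σ₂) (A := n) (C := 0)
      (fun i hi => by simp [hσ₂, reg_add, reg_const, hi, hq.eq_iff, hn₁ i hi, hz i hi])
      (fun i hi => by simp [hσ₂, reg_add, reg_const, hi, hq.eq_iff, p₁ i hi, hz i hi])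
      (fun i hi => by simp [hσ₂, reg_const, hi])
      (fun i hi => by simp [hσ₂, reg_add, reg_const, hq.eq_iff, hz i hi])
    have hz₃ : ∀ i ∈ act, σ₃.reg i (q 8) = 0 := fun i hi => by
      rw [f₃ i _ fun j hj h => by have := hq h; omega,
        f₂ i _ fun j hj h => by have := hq h; omega, hz i hi]
    refine ⟨_, _, .seq e₁ (.seq e₂ (.seq e₃ (.instr _ _ _))), ?_, ?_, fun i hi => ?_,
      fun i r hr => ?_⟩
    · have hsize : Nat.size (n ^ k) ≤ k * Nat.size n + 1 := by
        rw [Nat.size_le]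
        calc n ^ k ≤ (2 ^ Nat.size n) ^ k := Nat.pow_le_pow_left (Nat.lt_size_self n).le k
          _ = 2 ^ (k * Nat.size n) := by rw [← pow_mul, mul_comm]
          _ < _ := Nat.pow_lt_pow_right (by norm_num) (Nat.lt_succ_self _)
      nlinarith
    · rw [mem_add, m₃, ← m₁]
      rfl
    · simp [reg_add, hi, c₃ i hi, hz₃ i hi, pow_succ, mul_comm]
    · rw [reg_add, if_neg fun h => hr 7 (by norm_num) h.2, f₃ i r fun j hj => hr j (by omega),
        f₂ i r hr, f₁ i r hr]

end Arithmetic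

/-! ### Subroutines -/

section Subroutine

variable {α : Type} [Fintype α]

lemma encodeArray_eq_zero_iff (x : List α) (i : ℕ) : encodeArray x i = 0 ↔ x.length ≤ i := by
  rw [← List.getElem?_eq_none_iff, encodeArray]
  cases x[i]? <;> simp

/-- A linear blow-up adds only a constant to the logarithm, so polylogarithmic time in an
intermediate string stays polylogarithmic in the input. -/
lemma log_add_two_le {c m n : ℕ} (h : m ≤ c * n + c) :
    Nat.log 2 m + 2 ≤ (Nat.log 2 n + 2) ^ (c + 2) := by
  set L := Nat.log 2 n
  have hn : n + 1 ≤ 2 ^ (L + 1) := Nat.lt_pow_succ_log_self (by norm_num) n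
  have hc : c ≤ 2 ^ c := (Nat.lt_pow_self (by norm_num)).le
  have hm : m ≤ 2 ^ (c + (L + 1)) :=
    calc m ≤ c * (n + 1) := by rw [mul_add, mul_one]; exact h
      _ ≤ 2 ^ c * 2 ^ (L + 1) := Nat.mul_le_mul hc hn
      _ = _ := (pow_add _ _ _).symm
  have hlog : Nat.log 2 m ≤ c + (L + 1) :=
    (Nat.log_mono_right hm).trans (Nat.log_pow (by norm_num) _).le
  have hpow : c + 2 ≤ (L + 2) ^ (c + 1) := Nat.lt_pow_self (by omega)
  calc Nat.log 2 m + 2 ≤ (c + 2) * (L + 2) := by nlinarith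
    _ ≤ (L + 2) ^ (c + 1) * (L + 2) := Nat.mul_le_mul_right _ hpow
    _ = _ := by ring

lemma length_add_two_le {c m n : ℕ} (h : m ≤ c * n + c) : m + 2 ≤ (n + 2) ^ (c + 2) := by
  have hpow : c + 2 ≤ (n + 2) ^ (c + 1) := Nat.lt_pow_self (by omega)
  calc m + 2 ≤ (c + 2) * (n + 2) := by nlinarith
    _ ≤ (n + 2) ^ (c + 1) * (n + 2) := Nat.mul_le_mul_right _ hpow
    _ = _ := by ring

/-- The registers and arrays of the class `s` hold zeros only. -/
def PRAMState.Fresh (s : ℕ) (τ : PRAMState) : Prop :=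
  (∀ i r, (Nat.unpair r).1 = s → τ.reg i r = 0) ∧ ∀ a, (Nat.unpair a).1 = s → τ.mem a = fun _ => 0

/-- The states agree on all registers and arrays, except for those of the class `s` and for the
array `b`. -/
def PRAMState.SameOutside (s b : ℕ) (τ τ' : PRAMState) : Prop :=
  (∀ i r, (Nat.unpair r).1 ≠ s → τ'.reg i r = τ.reg i r) ∧
    ∀ a, (Nat.unpair a).1 ≠ s → a ≠ b → τ'.mem a = τ.mem a

lemma PRAMState.Fresh.of_sameOutside {s s' b : ℕ} {τ τ' : PRAMState} (h : τ.Fresh s)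
    (h' : τ.SameOutside s' b τ') (hs : s ≠ s') (hb : (Nat.unpair b).1 ≠ s) : τ'.Fresh s :=
  ⟨fun i r hr => (h'.1 i r (by rw [hr]; exact hs)).trans (h.1 i r hr),
    fun a ha => (h'.2 a (by rw [ha]; exact hs) (by rintro rfl; exact hb ha)).trans (h.2 a ha)⟩

/-- Arrays of a program that is used as a subroutine with the output array `b`. -/
def subArray (s b : ℕ) : ℕ → ℕ := fun a => if a = 1 then b else Nat.pair s a

lemma subArray_injective {s b : ℕ} (hb : (Nat.unpair b).1 ≠ s) :
    Function.Injective (subArray s b) := by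
  intro a a' h
  simp only [subArray] at h
  split_ifs at h with h₁ h₂ h₂
  · rw [h₁, h₂]
  · exact absurd (by rw [h, Nat.unpair_pair]) hb
  · exact absurd (by rw [← h, Nat.unpair_pair]) hb
  · exact (Nat.pair_eq_pair.1 h).2

/-- Copies the array `a` to the first array of the class `s`, computes the length of the string in
it, and determines which processors take part in the subroutine. -/
def maskProg (s a k : ℕ) : PRAMProg :=
  .seq (.block (.pid (Nat.pair s 10)) [.load (Nat.pair s 11) a (Nat.pair s 10)])
    (.seq (.instr (.store (Nat.pair s 0) (Nat.pair s 10) (Nat.pair s 11)))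
      (.seq (.instr (.store (Nat.pair s 1) (Nat.pair s 11) (Nat.pair s 10)))
        (.seq (.instr (.load (Nat.pair s 9) (Nat.pair s 1) (Nat.pair s 8)))
          (.seq (powProg (Nat.pair s) k)
            (.block (.const (Nat.pair s 12) k)
              [.add (Nat.pair s 7) (Nat.pair s 7) (Nat.pair s 12),
                .sub (Nat.pair s 13) (Nat.pair s 7) (Nat.pair s 10)])))))

lemma pair_right_injective (s : ℕ) : Function.Injective (Nat.pair s) :=
  fun _ _ h => (Nat.pair_eq_pair.1 h).2

/-- The length is found in constant time: processor `i` writes its number to the cell whose address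
is entry `i`. Exactly the entries behind the string are 0, so among the processors competing for
cell 0 the smallest, number `x.length`, wins. This is why `N` must exceed the length. -/
lemma maskProg_exec {s a k N : ℕ} {x : List α} {τ : PRAMState} (hN : x.length < N)
    (hx : τ.mem a = encodeArray x) (hs : τ.Fresh s) :
    ∃ t τ', PRAMExec (maskProg s a k) {i | i < N} τ t τ' ∧
      t ≤ 9 + k * (9 * k * Nat.size x.length + 14) ∧
      τ'.mem (Nat.pair s 0) = encodeArray x ∧
      (∀ c, c ≠ Nat.pair s 0 → c ≠ Nat.pair s 1 → τ'.mem c = τ.mem c) ∧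
      (∀ i < N, τ'.reg i (Nat.pair s 13) = x.length ^ k + k - i) ∧
      ∀ i r, (∀ j < 14, r ≠ Nat.pair s j) → τ'.reg i r = τ.reg i r := by
  set q := Nat.pair s with hqdef
  have hq : Function.Injective q := pair_right_injective s
  set act : Set ℕ := {i | i < N} with hact
  have hmem : ∀ {i}, i ∈ act ↔ i < N := Iff.rfl
  have hclass : ∀ j, (Nat.unpair (q j)).1 = s := fun j => by simp [q]
  have hz : ∀ i j, τ.reg i (q j) = 0 := fun i j => hs.1 i _ (hclass j)
  have hlt : ∀ j, encodeArray x j ≠ 0 → j < N := fun j hj => by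
    rw [Ne, encodeArray_eq_zero_iff] at hj
    omega
  set τ₁ := [PRAMInstr.pid (q 10), .load (q 11) a (q 10)].foldl (PRAMInstr.apply act) τ with hτ₁
  have r₁ : ∀ i ∈ act, τ₁.reg i (q 10) = i ∧ τ₁.reg i (q 11) = encodeArray x i := fun i hi => by
    simp [hτ₁, reg_pid, reg_load, mem_pid, hi, hq.eq_iff, hx]
  have f₁ : ∀ i r, (∀ j < 14, r ≠ q j) → τ₁.reg i r = τ.reg i r := fun i r hr => by
    simp [hτ₁, reg_pid, reg_load, hr]
  have z₁ : ∀ i, τ₁.reg i (q 8) = 0 := fun i => by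
    simp [hτ₁, reg_pid, reg_load, hq.eq_iff, hz]
  set τ₂ := PRAMInstr.apply act τ₁ (.store (q 0) (q 10) (q 11)) with hτ₂
  have m₂ : τ₂.mem (q 0) = encodeArray x := by
    funext j
    by_cases hj : j < N
    · rw [hτ₂, mem_store_of_hit (i := j) (hmem.2 hj) (r₁ j hj).1
        (fun i' hi' h => by rw [(r₁ i' hi').1] at h; omega), (r₁ j hj).2]
    · rw [hτ₂, mem_store_of_miss fun i hi => by
        rw [(r₁ i hi).1]
        rintro rfl
        exact hj hi]
      have : encodeArray x j = 0 := by
        by_contra h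
        exact hj (hlt j h)
      rw [this]
      change τ.mem (q 0) j = 0
      rw [hs.2 _ (hclass 0)]
  set τ₃ := PRAMInstr.apply act τ₂ (.store (q 1) (q 11) (q 10)) with hτ₃
  have m₃ : τ₃.mem (q 1) 0 = x.length := by
    rw [hτ₃, mem_store_of_hit (i := x.length) (hmem.2 hN)]
    · exact (r₁ _ hN).1
    · rw [hτ₂, reg_store, (r₁ _ hN).2, encodeArray_eq_zero_iff]
    · intro i' hi' h
      rwa [hτ₂, reg_store, (r₁ _ hi').2, encodeArray_eq_zero_iff] at h
  set τ₄ := PRAMInstr.apply act τ₃ (.load (q 9) (q 1) (q 8)) with hτ₄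
  have r₄ : ∀ i ∈ act, τ₄.reg i (q 9) = x.length := fun i hi => by
    rw [hτ₄, reg_load, if_pos ⟨hi, rfl⟩]
    change τ₃.mem (q 1) (τ₁.reg i (q 8)) = _
    rw [z₁, m₃]
  have f₄ : ∀ i r, r ≠ q 9 → τ₄.reg i r = τ₁.reg i r := fun i r hr => by
    rw [hτ₄, reg_load, if_neg fun h => hr h.2]
    rfl
  obtain ⟨t, τ₅, e₅, t₅, m₅, r₅, f₅⟩ := powProg_exec hq (act := act) ⟨_, hN⟩ k r₄
    (fun i _ => by rw [f₄ i _ (hq.ne (by norm_num)), z₁])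
  refine ⟨_, _, .seq (.block _ _ _ _) (.seq (.instr _ _ _) (.seq (.instr _ _ _)
    (.seq (.instr _ _ _) (.seq e₅ (.block _ _ _ _))))), ?_, ?_, ?_, ?_, ?_⟩
  · simp only [List.length_cons, List.length_nil]
    omega
  · change τ₅.mem (q 0) = _
    rw [m₅, hτ₄, mem_load, hτ₃, mem_store_of_ne _ _ _ _ (hq.ne (by norm_num)), m₂]
  · intro c h₀ h₁
    change τ₅.mem c = _
    rw [m₅, hτ₄, mem_load, hτ₃, mem_store_of_ne _ _ _ _ h₁, hτ₂, mem_store_of_ne _ _ _ _ h₀]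
    rfl
  · intro i hi
    have h₁₀ : τ₅.reg i (q 10) = i := by
      rw [f₅ i _ (fun j hj => hq.ne (by omega)), f₄ i _ (hq.ne (by norm_num)), (r₁ i hi).1]
    simp [← hqdef, reg_const, reg_add, reg_sub, hq.eq_iff, hmem.2 hi, r₅ i hi, h₁₀]
  · intro i r hr
    have : τ₅.reg i r = τ.reg i r := by
      rw [f₅ i r fun j hj => hr j (by omega), f₄ i r (hr 9 (by norm_num)), f₁ i r hr]
    simp [← hqdef, reg_const, reg_add, reg_sub, hr, this]

/-- An NC computable function can be computed as a subroutine, with the input in the array `a` and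
the output in the array `b`, using the registers and arrays of the class `s`. -/
theorem NCComputable.subroutine {f : List α → List α} (hf : NCComputable f) {a b s : ℕ}
    (hb : (Nat.unpair b).1 ≠ s) :
    ∃ (p : PRAMProg) (K : ℕ), ∀ (x : List α) (N : ℕ) (τ : PRAMState),
      (x.length + 2) ^ K ≤ N → τ.mem a = encodeArray x → (τ.mem b = fun _ => 0) → τ.Fresh s →
      ∃ t τ', PRAMExec p {i | i < N} τ t τ' ∧ t ≤ (Nat.log 2 x.length + 2) ^ K ∧
        τ'.mem b = encodeArray (f x) ∧ τ.SameOutside s b τ' := by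
  obtain ⟨p, k, hp⟩ := hf
  -- Smaller register numbers of the class belong to the mask computation and to the dummy branch.
  let φ : ℕ → ℕ := fun r => Nat.pair s (r + 16)
  have hφ : Function.Injective φ := fun r r' h => by
    have := pair_right_injective s h
    omega
  have hψ := subArray_injective hb
  let D := (9 + k * (9 * k + 14)) + 9 * k * k + 2
  refine ⟨.seq (maskProg s a k) (.ite (Nat.pair s 13) (p.rename φ (subArray s b))
    (.instr (.const (Nat.pair s 14) 0))), (D + 1) + (2 * k + 1) + 1, fun x N τ hN hx hb₀ hs => ?_⟩
  have hN₁ : x.length < N := by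
    refine lt_of_lt_of_le (show x.length < x.length + 2 by omega) (le_trans ?_ hN)
    exact Nat.le_self_pow (by omega) _
  have hN₂ : x.length ^ k + k ≤ N := by
    refine (pow_add_const_le k x.length).trans (le_trans ?_ hN)
    exact Nat.pow_le_pow_right (by omega) (by omega)
  obtain ⟨t₁, τ₁, e₁, ht₁, m₁, g₁, r₁, f₁⟩ := maskProg_exec (k := k) hN₁ hx hs
  -- The array `Nat.pair s 1`, left dirty by the length computation, is invisible, as array 1 of the
  -- subprogram is mapped to `b`.
  have hpull : τ₁.pull φ (subArray s b) = PRAMState.initial x := by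
    simp only [PRAMState.pull, PRAMState.initial, PRAMState.mk.injEq]
    refine ⟨?_, ?_⟩
    · funext i r
      rw [f₁ i _ fun j hj h => by have := pair_right_injective s h; omega]
      exact hs.1 i _ (by simp [φ])
    · funext c
      match c with
      | 0 => simpa [subArray] using m₁
      | 1 =>
        simp only [subArray, if_true, one_ne_zero, if_false]
        rw [g₁ b (by rintro rfl; simp at hb) (by rintro rfl; simp at hb), hb₀]
      | c + 2 =>
        have hc : subArray s b (c + 2) = Nat.pair s (c + 2) := if_neg (by omega)
        rw [hc, g₁ _ (fun h => by have := pair_right_injective s h; omega)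
          (fun h => by have := pair_right_injective s h; omega), hs.2 _ (by simp)]
        rfl
  obtain ⟨t₂, σ, e₂, ht₂, m₂⟩ := hp x
  obtain ⟨τ₂, e₂', p₂, a₂⟩ := e₂.rename hφ hψ τ₁ hpull
  -- The truncated difference in register 13 is nonzero exactly for the processors that the given
  -- program was promised.
  have hset : {i | i < x.length ^ k + k} =
      {i | i ∈ {i | i < N} ∧ τ₁.reg i (Nat.pair s 13) ≠ 0} := by
    ext i
    simp only [Set.mem_ofPred_eq]
    constructor
    · intro hi
      refine ⟨by omega, ?_⟩
      rw [r₁ i (by omega)]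
      omega
    · rintro ⟨hi, h⟩
      rw [r₁ i hi] at h
      omega
  refine ⟨_, _, .seq e₁ (.ite (e₂'.cast hset rfl) (.instr _ _ _)), ?_, ?_, ?_, ?_⟩
  · set L := Nat.log 2 x.length
    have hsize : Nat.size x.length ≤ L + 1 :=
      Nat.size_le.2 (Nat.lt_pow_succ_log_self (by norm_num) _)
    have h₁ : t₁ + 2 ≤ (L + 2) ^ (D + 1) :=
      calc t₁ + 2 ≤ D * (L + 2) := by
            have := Nat.mul_le_mul_left (9 * k * k) hsize
            simp only [D]
            nlinarith
        _ ≤ (L + 2) ^ (D + 1) := by simpa using const_mul_pow_le D 1 L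
    have h₂ : t₂ ≤ (L + 2) ^ (2 * k + 1) := ht₂.trans (mul_pow_add_const_le k L)
    have h₃ := add_pow_le_pow (D + 1) (2 * k + 1) L
    omega
  · rw [mem_const, ← m₂, ← p₂]
    simp [PRAMState.pull, subArray]
  · intro i r hr
    have hr' : ∀ j, r ≠ Nat.pair s j := fun j h => hr (by rw [h, Nat.unpair_pair])
    rw [reg_const, if_neg fun h => hr' _ h.2, a₂.1 i r fun r' => hr' _, f₁ i r fun j _ => hr' j]
  · intro c hc hcb
    have hc' : ∀ j, c ≠ Nat.pair s j := fun j h => hc (by rw [h, Nat.unpair_pair])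
    rw [mem_const, a₂.2 c, g₁ c (hc' 0) (hc' 1)]
    intro a'
    simp only [subArray]
    split_ifs
    · exact hcb
    · exact hc' _

/-- A program for all large numbers of processors shows that a function is NC computable. -/
lemma ncComputable_of_exec {f : List α → List α} (p : PRAMProg) (K : ℕ)
    (h : ∀ (x : List α) (N : ℕ), (x.length + 2) ^ K ≤ N → ∃ t τ,
      PRAMExec p {i | i < N} (PRAMState.initial x) t τ ∧ t ≤ (Nat.log 2 x.length + 2) ^ K ∧
      τ.mem 1 = encodeArray (f x)) : NCComputable f := by
  obtain ⟨k, hk, hpow⟩ := pow_le_pow_add_const K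
  refine ⟨p, k, fun x => ?_⟩
  obtain ⟨t, τ, e, ht, m⟩ := h x _ (hpow x.length)
  refine ⟨t, τ, e, ht.trans ((hpow _).trans ?_), m⟩
  exact Nat.add_le_add_right (Nat.le_mul_of_pos_left _ hk) k

lemma PRAMState.fresh_initial (x : List α) {s : ℕ} (hs : s ≠ 0) :
    (PRAMState.initial x).Fresh s := by
  refine ⟨fun _ _ _ => rfl, fun a ha => ?_⟩
  have : a ≠ 0 := by
    rintro rfl
    exact hs (by simpa using ha.symm)
  simp [PRAMState.initial, this]

lemma PRAMState.mem_initial_of_ne (x : List α) {a : ℕ} (ha : a ≠ 0) :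
    (PRAMState.initial x).mem a = fun _ => 0 := if_neg ha

end Subroutine

/-! ### NC computability of pairs -/

section NCPair

variable {α : Type} [Fintype α]

lemma encodeArray_nil (i : ℕ) : encodeArray ([] : List α) i = 0 := rfl

lemma encodeArray_cons_zero (a : α) (l : List α) :
    encodeArray (a :: l) 0 = (Fintype.equivFin α a : ℕ) + 1 := rfl

lemma encodeArray_cons_succ (a : α) (l : List α) (i : ℕ) :
    encodeArray (a :: l) (i + 1) = encodeArray l i := rfl

/-- Symbols have positive numbers, so `1 - encodeArray u i` indicates absence. Added to 1 it yields
the entry of `yes` or `no`; added to the entry itself it replaces a missing symbol by `yes`. -/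
lemma encodeArray_pairCode {yes no : α} (hyes : (Fintype.equivFin α yes : ℕ) = 0)
    (hno : (Fintype.equivFin α no : ℕ) = 1) (u v : List α) (i : ℕ) :
    encodeArray (pairCode yes no u v) (4 * i + 0) =
        (if encodeArray u i + encodeArray v i = 0 then 0 else 1 + (1 - encodeArray u i)) ∧
      encodeArray (pairCode yes no u v) (4 * i + 1) =
        (if encodeArray u i + encodeArray v i = 0 then 0
          else encodeArray u i + (1 - encodeArray u i)) ∧
      encodeArray (pairCode yes no u v) (4 * i + 2) =
        (if encodeArray u i + encodeArray v i = 0 then 0 else 1 + (1 - encodeArray v i)) ∧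
      encodeArray (pairCode yes no u v) (4 * i + 3) =
        (if encodeArray u i + encodeArray v i = 0 then 0
          else encodeArray v i + (1 - encodeArray v i)) := by
  fun_induction pairCode yes no u v generalizing i with
  | case1 => simp [encodeArray_nil]
  | _ =>
    rename_i ih
    cases i with
    | zero =>
      simp [encodeArray_cons_zero, encodeArray_cons_succ, encodeArray_nil, hyes, hno]
    | succ i =>
      simpa [encodeArray_cons_succ, encodeArray_nil, mul_add, add_right_comm _ 4] using ih i

/-- The processors compute the positions and the symbols of the code of the pair of the strings in
the arrays `a` and `a'`. -/
def pairPrelude (s a a' : ℕ) : List PRAMInstr :=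
  [.load (Nat.pair s 1) a (Nat.pair s 0), .load (Nat.pair s 2) a' (Nat.pair s 0),
    .const (Nat.pair s 3) 1,
    .sub (Nat.pair s 4) (Nat.pair s 3) (Nat.pair s 1),
    .add (Nat.pair s 5) (Nat.pair s 3) (Nat.pair s 4),
    .add (Nat.pair s 6) (Nat.pair s 1) (Nat.pair s 4),
    .sub (Nat.pair s 7) (Nat.pair s 3) (Nat.pair s 2),
    .add (Nat.pair s 8) (Nat.pair s 3) (Nat.pair s 7),
    .add (Nat.pair s 9) (Nat.pair s 2) (Nat.pair s 7),
    .add (Nat.pair s 10) (Nat.pair s 1) (Nat.pair s 2),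
    .add (Nat.pair s 11) (Nat.pair s 0) (Nat.pair s 0),
    .add (Nat.pair s 12) (Nat.pair s 11) (Nat.pair s 11),
    .add (Nat.pair s 13) (Nat.pair s 12) (Nat.pair s 3),
    .add (Nat.pair s 14) (Nat.pair s 13) (Nat.pair s 3),
    .add (Nat.pair s 15) (Nat.pair s 14) (Nat.pair s 3)]

/-- Writes the code of the pair of the strings in the arrays `a` and `a'` to the array `b`. -/
def pairProg (s a a' b : ℕ) : PRAMProg :=
  .seq (.block (.pid (Nat.pair s 0)) (pairPrelude s a a'))
    (.ite (Nat.pair s 10)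
      (.block (.store b (Nat.pair s 12) (Nat.pair s 5))
        [.store b (Nat.pair s 13) (Nat.pair s 6), .store b (Nat.pair s 14) (Nat.pair s 8),
          .store b (Nat.pair s 15) (Nat.pair s 9)])
      (.instr (.const (Nat.pair s 16) 0)))

/-- Block `i` has a fixed address, so processor `i` needs only entry `i` of each string. Processors
beyond both strings write nothing and leave the zeros that end the code. -/
lemma pairProg_exec {yes no : α} (hyes : (Fintype.equivFin α yes : ℕ) = 0)
    (hno : (Fintype.equivFin α no : ℕ) = 1) {s a a' b N : ℕ} {u v : List α} {τ : PRAMState}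
    (hu : u.length ≤ N) (hv : v.length ≤ N) (hau : τ.mem a = encodeArray u)
    (hav : τ.mem a' = encodeArray v) (hb : τ.mem b = fun _ => 0) :
    ∃ τ', PRAMExec (pairProg s a a' b) {i | i < N} τ 22 τ' ∧
      τ'.mem b = encodeArray (pairCode yes no u v) := by
  set q := Nat.pair s with hqdef
  have hq : Function.Injective q := pair_right_injective s
  set act : Set ℕ := {i | i < N} with hact
  set U := encodeArray u
  set V := encodeArray v
  have e₁ := PRAMExec.block act (.pid (q 0)) (pairPrelude s a a') τ
  set τ₁ := (PRAMInstr.pid (q 0) :: pairPrelude s a a').foldl (PRAMInstr.apply act) τ with hτ₁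
  have m₁ : τ₁.mem = τ.mem := rfl
  have r₁ : ∀ i ∈ act, τ₁.reg i (q 10) = U i + V i ∧ τ₁.reg i (q 5) = 1 + (1 - U i) ∧
      τ₁.reg i (q 6) = U i + (1 - U i) ∧ τ₁.reg i (q 8) = 1 + (1 - V i) ∧
      τ₁.reg i (q 9) = V i + (1 - V i) ∧ τ₁.reg i (q 12) = i + i + (i + i) ∧
      τ₁.reg i (q 13) = i + i + (i + i) + 1 ∧ τ₁.reg i (q 14) = i + i + (i + i) + 1 + 1 ∧
      τ₁.reg i (q 15) = i + i + (i + i) + 1 + 1 + 1 := fun i hi => by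
    simp [hτ₁, pairPrelude, ← hqdef, reg_pid, reg_load, reg_const, reg_sub, reg_add, mem_pid,
      mem_load, hi, hq.eq_iff, hau, hav]
  set act' : Set ℕ := {i | i ∈ act ∧ τ₁.reg i (q 10) ≠ 0} with hact'
  have hmem : ∀ i, i ∈ act' ↔ U i + V i ≠ 0 := by
    intro i
    constructor
    · rintro ⟨hi, h⟩
      rwa [(r₁ i hi).1] at h
    · intro h
      have hi : i ∈ act := by
        by_contra hi
        have hi' : N ≤ i := not_lt.1 hi
        have h₁ : U i = 0 := (encodeArray_eq_zero_iff u i).2 (by omega)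
        have h₂ : V i = 0 := (encodeArray_eq_zero_iff v i).2 (by omega)
        omega
      exact ⟨hi, by rwa [(r₁ i hi).1]⟩
  refine ⟨_, (PRAMExec.seq e₁ (.ite (.block act' _ _ _) (.instr _ _ _))).cast rfl rfl, ?_⟩
  rw [mem_const]
  have h₀ : ∀ i ∈ act', τ₁.reg i (q 12) = 4 * i + 0 := fun i hi => by
    rw [(r₁ i hi.1).2.2.2.2.2.1]; ring
  have h₁ : ∀ i ∈ act', τ₁.reg i (q 13) = 4 * i + 1 := fun i hi => by
    rw [(r₁ i hi.1).2.2.2.2.2.2.1]; ring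
  have h₂ : ∀ i ∈ act', τ₁.reg i (q 14) = 4 * i + 2 := fun i hi => by
    rw [(r₁ i hi.1).2.2.2.2.2.2.2.1]; ring
  have h₃ : ∀ i ∈ act', τ₁.reg i (q 15) = 4 * i + 3 := fun i hi => by
    rw [(r₁ i hi.1).2.2.2.2.2.2.2.2]; ring
  funext j
  obtain ⟨i, d, hd, rfl⟩ : ∃ i d, d < 4 ∧ j = 4 * i + d := ⟨j / 4, j % 4, by omega, by omega⟩
  simp only [List.foldl_cons, List.foldl_nil, ← hqdef]
  rw [mem_store_mul_four_add (k := 3) (by norm_num) ?_ hd,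
    mem_store_mul_four_add (k := 2) (by norm_num) ?_ hd,
    mem_store_mul_four_add (k := 1) (by norm_num) ?_ hd,
    mem_store_mul_four_add (k := 0) (by norm_num) ?_ hd]
  rotate_left
  · exact h₀
  · exact h₁
  · exact h₂
  · exact h₃
  simp only [reg_store, m₁, hb]
  obtain ⟨c₀, c₁, c₂, c₃⟩ := encodeArray_pairCode hyes hno u v i
  by_cases hi : i ∈ act'
  · have hi' := (hmem i).1 hi
    obtain ⟨-, r5, r6, r8, r9, -⟩ := r₁ i hi.1
    rw [if_neg hi'] at c₀ c₁ c₂ c₃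
    interval_cases d
    · rw [c₀]; simp [hi, r5, U]
    · rw [c₁]; simp [hi, r6, U]
    · rw [c₂]; simp [hi, r8, V]
    · rw [c₃]; simp [hi, r9, V]
  · have hi' : U i + V i = 0 := by
      by_contra h
      exact hi ((hmem i).2 h)
    rw [if_pos hi'] at c₀ c₁ c₂ c₃
    interval_cases d
    · rw [c₀]; simp [hi]
    · rw [c₁]; simp [hi]
    · rw [c₂]; simp [hi]
    · rw [c₃]; simp [hi]

lemma unpair_one : Nat.unpair 1 = (0, 1) := Nat.unpair_pair 0 1

/-- Input, output and intermediate arrays lie in class 0, while the subroutines use the classes 1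
and 2, so the second one starts on fresh memory. -/
theorem NCComputable.comp {f g : List α → List α} (hg : NCComputable g) (hf : NCComputable f)
    (hlin : LinearSize f) : NCComputable fun x => g (f x) := by
  obtain ⟨c, hc⟩ := hlin
  obtain ⟨p₁, K₁, h₁⟩ := hf.subroutine (a := 0) (b := Nat.pair 0 2) (s := 1) (by simp)
  obtain ⟨p₂, K₂, h₂⟩ := hg.subroutine (a := Nat.pair 0 2) (b := 1) (s := 2)
    (by simp [unpair_one])
  have h12 : (1 : ℕ) ≠ Nat.pair 0 2 := by decide
  refine ncComputable_of_exec (.seq p₁ p₂) (K₁ + (c + 2) * K₂ + 1) fun x N hN => ?_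
  obtain ⟨t₁, τ₁, e₁, ht₁, m₁, s₁⟩ := h₁ x N (PRAMState.initial x)
    (le_trans (Nat.pow_le_pow_right (by omega) (by omega)) hN) rfl
    (PRAMState.mem_initial_of_ne x (by decide)) (PRAMState.fresh_initial x (by norm_num))
  obtain ⟨t₂, τ₂, e₂, ht₂, m₂, -⟩ := h₂ (f x) N τ₁
    (by
      refine le_trans (Nat.pow_le_pow_left (length_add_two_le (hc x)) K₂) (le_trans ?_ hN)
      rw [← pow_mul]
      exact Nat.pow_le_pow_right (by omega) (by omega)) m₁
    (by
      rw [s₁.2 1 (by simp [unpair_one]) h12]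
      exact PRAMState.mem_initial_of_ne x (by norm_num))
    ((PRAMState.fresh_initial x (by norm_num)).of_sameOutside s₁ (by norm_num) (by simp))
  refine ⟨_, τ₂, .seq e₁ e₂, ?_, m₂⟩
  refine le_trans (Nat.add_le_add ht₁ (ht₂.trans ?_)) (add_pow_le_pow _ _ _)
  rw [pow_mul]
  exact Nat.pow_le_pow_left (log_add_two_le (hc x)) K₂

theorem NCComputable.pairCode {yes no : α} (hyes : (Fintype.equivFin α yes : ℕ) = 0)
    (hno : (Fintype.equivFin α no : ℕ) = 1) {f g : List α → List α} (hf : NCComputable f)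
    (hg : NCComputable g) (hlf : LinearSize f) (hlg : LinearSize g) :
    NCComputable fun x => pairCode yes no (f x) (g x) := by
  obtain ⟨c, hc⟩ := hlf
  obtain ⟨c', hc'⟩ := hlg
  obtain ⟨p₁, K₁, h₁⟩ := hf.subroutine (a := 0) (b := Nat.pair 0 2) (s := 1) (by simp)
  obtain ⟨p₂, K₂, h₂⟩ := hg.subroutine (a := 0) (b := Nat.pair 0 3) (s := 2) (by simp)
  have n₁₂ : (1 : ℕ) ≠ Nat.pair 0 2 := by decide
  have n₁₃ : (1 : ℕ) ≠ Nat.pair 0 3 := by decide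
  have n₀₂ : (0 : ℕ) ≠ Nat.pair 0 2 := by decide
  have n₂₃ : Nat.pair 0 2 ≠ Nat.pair 0 3 := by decide
  -- The summands `c` and `c'` in the exponent provide a processor for every position of either
  -- string; 22 is the time of `pairProg`.
  refine ncComputable_of_exec (.seq p₁ (.seq p₂ (pairProg 3 (Nat.pair 0 2) (Nat.pair 0 3) 1)))
    (K₁ + (K₂ + 22 + 1) + 1 + c + c' + 2) fun x N hN => ?_
  have hpow : ∀ k ≤ K₁ + (K₂ + 22 + 1) + 1 + c + c' + 2, (x.length + 2) ^ k ≤ N :=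
    fun k hk => (Nat.pow_le_pow_right (by omega) hk).trans hN
  obtain ⟨t₁, τ₁, e₁, ht₁, m₁, s₁⟩ := h₁ x N (PRAMState.initial x) (hpow _ (by omega)) rfl
    (PRAMState.mem_initial_of_ne x n₀₂.symm) (PRAMState.fresh_initial x (by norm_num))
  obtain ⟨t₂, τ₂, e₂, ht₂, m₂, s₂⟩ := h₂ x N τ₁ (hpow _ (by omega))
    (by rw [s₁.2 0 (by simp) n₀₂]; rfl)
    (by
      rw [s₁.2 _ (by simp) n₂₃.symm]
      exact PRAMState.mem_initial_of_ne x (by decide))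
    ((PRAMState.fresh_initial x (by norm_num)).of_sameOutside s₁ (by norm_num) (by simp))
  obtain ⟨τ₃, e₃, m₃⟩ := pairProg_exec hyes hno (s := 3) (a := Nat.pair 0 2)
    (a' := Nat.pair 0 3) (b := 1) (N := N) (u := f x) (v := g x) (τ := τ₂)
    (by have := length_add_two_le (hc x); have := hpow (c + 2) (by omega); omega)
    (by have := length_add_two_le (hc' x); have := hpow (c' + 2) (by omega); omega)
    (by rw [s₂.2 _ (by simp) n₂₃, m₁]) m₂
    (by
      rw [s₂.2 1 (by simp [unpair_one]) n₁₃, s₁.2 1 (by simp [unpair_one]) n₁₂]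
      exact PRAMState.mem_initial_of_ne x (by norm_num))
  refine ⟨_, τ₃, .seq e₁ (.seq e₂ e₃), ?_, m₃⟩
  have h := add_pow_le_pow K₂ 22 (Nat.log 2 x.length)
  have h' := add_pow_le_pow K₁ (K₂ + 22 + 1) (Nat.log 2 x.length)
  have h'' := const_le_pow 22 (Nat.log 2 x.length)
  refine le_trans ?_ (Nat.pow_le_pow_right (by omega)
    (show K₁ + (K₂ + 22 + 1) + 1 ≤ K₁ + (K₂ + 22 + 1) + 1 + c + c' + 2 by omega))
  omega

end NCPair

/-! ### Linear size under composition and pairing, and transitivity -/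

lemma LinearSize.comp {α : Type} {f g : List α → List α} (hg : LinearSize g)
    (hf : LinearSize f) : LinearSize fun x => g (f x) := by
  obtain ⟨c, hc⟩ := hf
  obtain ⟨c', hc'⟩ := hg
  refine ⟨c' * c + c', fun x => (hc' (f x)).trans ?_⟩
  have := Nat.mul_le_mul_left c' (hc x)
  nlinarith

lemma LinearSize.pairCode {α : Type} (yes no : α) {f g : List α → List α} (hf : LinearSize f)
    (hg : LinearSize g) : LinearSize fun x => pairCode yes no (f x) (g x) := by
  obtain ⟨c, hc⟩ := hf
  obtain ⟨c', hc'⟩ := hg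
  refine ⟨4 * (c + c'), fun x => (length_pairCode_le yes no _ _).trans ?_⟩
  have := hc x
  have := hc' x
  nlinarith

end PsT

theorem theorem1 {α : Type} [Fintype α] [Nontrivial α] (P₁ P₂ P₃ : PsT.DecisionProblem α)
    (h₁₂ : PsT.PsTReducible P₁ P₂) (h₂₃ : PsT.PsTReducible P₂ P₃) :
    PsT.PsTReducible P₁ P₃ := by
  obtain ⟨f₁, f₂, g, nf₁, lf₁, nf₂, lf₂, hg, h⟩ := h₁₂
  obtain ⟨f₁', f₂', g', nf₁', lf₁', nf₂', lf₂', hg', h'⟩ := h₂₃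
  have hcard : 1 < Fintype.card α := Fintype.one_lt_card
  -- The flags are the symbols with array entries 1 and 2, which a program obtains by arithmetic.
  let yes : α := (Fintype.equivFin α).symm ⟨0, by omega⟩
  let no : α := (Fintype.equivFin α).symm ⟨1, hcard⟩
  have hyes : (Fintype.equivFin α yes : ℕ) = 0 := by simp [yes]
  have hno : (Fintype.equivFin α no : ℕ) = 1 := by simp [no]
  have hne : no ≠ yes := fun e => by
    rw [e, hyes] at hno
    exact zero_ne_one hno
  refine ⟨fun D => f₁' (f₁ D), fun D => PsT.pairCode yes no (f₂ D) (f₂' (f₁ D)),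
    fun x y => g' (PsT.transduce (PsT.unpairStep yes) (2, false) x)
      (g (PsT.transduce (PsT.unpairStep yes) (0, false) x) y),
    nf₁'.comp nf₁ lf₁, lf₁'.comp lf₁,
    nf₂.pairCode hyes hno (nf₂'.comp nf₁ lf₁) lf₂ (lf₂'.comp lf₁),
    lf₂.pairCode yes no (lf₂'.comp lf₁),
    hg.comp hg' (PsT.polyComputes_transduce _ _) (PsT.polyComputes_transduce _ _)
      (PsT.length_transduce_le _ _) (PsT.length_transduce_le _ _), fun D P => ?_⟩
  simp only [PsT.transduce_unpairStep_fst hne, PsT.transduce_unpairStep_snd hne]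
  rw [h, h']
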